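/- Let $G$ be a locally compact (Hausdorff) group, let $\lambda$ be its left regular representation on $L^2(G)$ and let $\mathrm{VN}(G)=\lambda(G)''$ be its group von Neumann algebra. Let $A(G)=\mathrm{VN}(G)_*$ be the Fourier algebra, with the norm and the canonical operator space structure of the predual; an element $\varphi\in A(G)$ is identified with the function $x\mapsto\varphi(\lambda(x))$ on $G$. Let $\mathcal M_{\mathrm{cb}}(A(G))$ be the algebra of all functions $f\colon G\to\mathbb C$ such that $fA(G)\subset A(G)$ and the multiplication operator $M_f\colon A(G)\to A(G)$ is completely bounded, with the norm $\|f\|_{\mathrm{cb}}:=\|M_f\|_{\mathrm{cb}}$, and let $A_{\mathrm{cb}}(G)$ be the closure of $A(G)$ in $\mathcal M_{\mathrm{cb}}(A(G))$. Call $G$ weakly amenable if $A_{\mathrm{cb}}(G)$ has a bounded approximate identity. For a closed set $F\subset G$ let $$I(F)=\{f\in A(G): f|_F\equiv 0\},\qquad I_{\mathrm{cb}}(F)=\{f\in A_{\mathrm{cb}}(G): f|_F\equiv 0\},$$ and let $J(F)$ and $J_{\mathrm{cb}}(F)$ be the closures of $$\{f\in A(G): \operatorname{supp}(f)\text{ is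 compact and } \operatorname{supp}(f)\cap F=\emptyset\}$$ in the norm of $A(G)$ and in the norm $\|\cdot\|_{\mathrm{cb}}$, respectively. The closed set $F$ is called a set of spectral synthesis for $A(G)$ if $J(F)=I(F)$, and a set of spectral synthesis for $A_{\mathrm{cb}}(G)$ if $J_{\mathrm{cb}}(F)=I_{\mathrm{cb}}(F)$. Proposition. If $G$ is weakly amenable and the closed set $F\subset G$ is a set of spectral synthesis for $A(G)$, then $F$ is a set of spectral synthesis for $A_{\mathrm{cb}}(G)$. -/

import Mathlib

open MeasureTheory Filter Topology
open scoped ENNReal NNReal InnerProductSpace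

universe u

namespace FourierAlg

noncomputable section

/-! ### Operator spaces: von Neumann algebras and their preduals -/

section OperatorSpace

variable {H : Type u} [NormedAddCommGroup H] [InnerProductSpace ℂ H] [CompleteSpace H]

/-- The elements of a von Neumann algebra, with the operator norm. -/
abbrev Elem (M : VonNeumannAlgebra H) : Type u := M.toStarSubalgebra

/-- The von Neumann algebra generated by a set of operators
(the double commutant of the set and its adjoints). -/
def generated (s : Set (H →L[ℂ] H)) : VonNeumannAlgebra H where
  toStarSubalgebra := StarSubalgebra.centralizer ℂ
    (StarSubalgebra.centralizer ℂ s : Set (H →L[ℂ] H))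
  centralizer_centralizer' := by
    show Set.centralizer (Set.centralizer
      (StarSubalgebra.centralizer ℂ
        (StarSubalgebra.centralizer ℂ s : Set (H →L[ℂ] H)) : Set (H →L[ℂ] H))) =
      (StarSubalgebra.centralizer ℂ
        (StarSubalgebra.centralizer ℂ s : Set (H →L[ℂ] H)) : Set (H →L[ℂ] H))
    simp only [StarSubalgebra.coe_centralizer, Set.centralizer_centralizer_centralizer]

theorem subset_generated (s : Set (H →L[ℂ] H)) {T : H →L[ℂ] H} (hT : T ∈ s) :
    T ∈ (generated s).toStarSubalgebra := by
  show T ∈ StarSubalgebra.centralizer ℂ (StarSubalgebra.centralizer ℂ s : Set (H →L[ℂ] H))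
  rw [StarSubalgebra.mem_centralizer_iff]
  intro g hg
  have hg' : g ∈ StarSubalgebra.centralizer ℂ s := hg
  have h1 := (StarSubalgebra.mem_centralizer_iff ℂ).1 hg' T hT
  have h2 := (StarSubalgebra.mem_centralizer_iff ℂ).1
    (star_mem (s := StarSubalgebra.centralizer ℂ s) hg') T hT
  exact ⟨h1.1.symm, h2.1.symm⟩

/-- The vector functional `T ↦ ⟨T ξ, η⟩` on a von Neumann algebra
(linear in `ξ`, conjugate linear in `η`). -/
def vectorFunctional (M : VonNeumannAlgebra H) (ξ η : H) : StrongDual ℂ (Elem M) :=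
  LinearMap.mkContinuous
    { toFun := fun T => ⟪η, (T : H →L[ℂ] H) ξ⟫_ℂ
      map_add' := fun S T => by simp
      map_smul' := fun c T => by simp }
    (‖η‖ * ‖ξ‖)
    (fun T => by
      have h1 := norm_inner_le_norm (𝕜 := ℂ) η ((T : H →L[ℂ] H) ξ)
      have h2 := (T : H →L[ℂ] H).le_opNorm ξ
      have h3 : ‖(T : H →L[ℂ] H)‖ = ‖T‖ := rfl
      rw [h3] at h2
      calc ‖⟪η, (T : H →L[ℂ] H) ξ⟫_ℂ‖ ≤ ‖η‖ * ‖(T : H →L[ℂ] H) ξ‖ := h1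
        _ ≤ ‖η‖ * (‖T‖ * ‖ξ‖) := by gcongr
        _ = ‖η‖ * ‖ξ‖ * ‖T‖ := by ring)

/-- The predual `M_*` of a von Neumann algebra `M`: the Banach space of its normal functionals,
that is, the norm closure in `M^*` of the linear span of the vector functionals. -/
def predual (M : VonNeumannAlgebra H) : Submodule ℂ (StrongDual ℂ (Elem M)) :=
  (Submodule.span ℂ {φ | ∃ ξ η : H, φ = vectorFunctional M ξ η}).topologicalClosure

/-- The operator on the Hilbert space `H^m` given by an `m × m` matrix of operators on `H`. -/
def matrixOp {m : ℕ} (T : Matrix (Fin m) (Fin m) (H →L[ℂ] H)) :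
    PiLp 2 (fun _ : Fin m => H) →L[ℂ] PiLp 2 (fun _ : Fin m => H) :=
  ((PiLp.continuousLinearEquiv 2 ℂ (fun _ : Fin m => H)).symm :
      (Fin m → H) →L[ℂ] PiLp 2 (fun _ : Fin m => H)) ∘L
    ContinuousLinearMap.pi (fun k => ∑ l, T k l ∘L PiLp.proj 2 (fun _ : Fin m => H) l)

/-- The matrix norm of `M_n(M_*)` given by the standard operator space structure of the predual
`M_* ⊆ M^*`, where `M_n(M^*) = CB(M, M_n(ℂ))`: the norm of `[φ_ij]` is the
completely bounded norm of `T ↦ [φ_ij(T)]`, i.e. the supremum of the operator norms of the scalar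
matrices `[φ_ij(T_kl)]`, over all `m` and all `[T_kl]` in the closed unit ball of `M_m(M)`. -/
def matNorm (M : VonNeumannAlgebra H) {n : ℕ}
    (φ : Matrix (Fin n) (Fin n) (predual M)) : ℝ≥0∞ :=
  ⨆ (m : ℕ) (T : Matrix (Fin m) (Fin m) (Elem M))
    (_ : ‖matrixOp (T.map (fun t => (t : H →L[ℂ] H)))‖ ≤ 1),
    ‖Matrix.toEuclideanCLM (n := Fin n × Fin m) (𝕜 := ℂ)
      (Matrix.of fun p q => (φ p.1 q.1 : StrongDual ℂ (Elem M)) (T p.2 q.2))‖ₑ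

/-- `cbOpNorm S` is the completely bounded norm of a linear map `S : M_* → M_*`
(it is `∞` if and only if `S` is not completely bounded). -/
def cbOpNorm (M : VonNeumannAlgebra H) (S : predual M →ₗ[ℂ] predual M) : ℝ≥0∞ :=
  ⨅ (C : ℝ≥0) (_ : ∀ (n : ℕ) (φ : Matrix (Fin n) (Fin n) (predual M)),
    matNorm M (φ.map S) ≤ C * matNorm M φ), (C : ℝ≥0∞)

end OperatorSpace

/-! ### The Fourier algebra and its completely bounded multipliers -/

section Group

variable (G : Type u) [Group G] [TopologicalSpace G] [IsTopologicalGroup G]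
  [LocallyCompactSpace G] [MeasurableSpace G] [BorelSpace G]

/-- `L²(G)` with respect to a left Haar measure. -/
abbrev L2 : Type u := Lp ℂ 2 (Measure.haar : Measure G)

/-- The left regular representation, `(λ(x) ξ)(y) = ξ(x⁻¹ y)`. -/
def leftReg (x : G) : L2 G →L[ℂ] L2 G :=
  (Lp.compMeasurePreservingₗᵢ ℂ (fun y : G => x⁻¹ * y)
    (measurePreserving_mul_left (Measure.haar : Measure G) x⁻¹)).toContinuousLinearMap

/-- The group von Neumann algebra `VN(G)`. -/
def VN : VonNeumannAlgebra (L2 G) := generated (Set.range (leftReg G))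

/-- `λ(x)` as an element of `VN(G)`. -/
def leftRegVN (x : G) : Elem (VN G) :=
  ⟨leftReg G x, subset_generated _ ⟨x, rfl⟩⟩

/-- The Fourier algebra `A(G) = VN(G)_*` with the norm of the predual; an element `φ` of it is
identified with the function `x ↦ φ(λ(x))` on `G`, see `FourierAlgebra.toFun`. -/
abbrev FourierAlgebra : Type u := predual (VN G)

variable {G}

/-- The function `x ↦ φ(λ(x))` on `G` given by an element `φ` of `A(G) = VN(G)_*`. -/
def FourierAlgebra.toFun (φ : FourierAlgebra G) : G → ℂ :=
  fun x => (φ : StrongDual ℂ (Elem (VN G))) (leftRegVN G x)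

/-- `S : A(G) → A(G)` is the multiplication operator `M_f` of the function `f : G → ℂ`. -/
def IsMultiplicationBy (f : G → ℂ) (S : FourierAlgebra G →ₗ[ℂ] FourierAlgebra G) : Prop :=
  ∀ (φ : FourierAlgebra G) (x : G),
    FourierAlgebra.toFun (S φ) x = f x * FourierAlgebra.toFun φ x

/-- The cb-multiplier norm of a function `f` on `G`: the completely bounded norm of the
multiplication operator `M_f` on `A(G)`, and `∞` if `f A(G) ⊄ A(G)` or if `M_f` is not
completely bounded. -/
def cbNorm (f : G → ℂ) : ℝ≥0∞ :=
  ⨅ (S : FourierAlgebra G →ₗ[ℂ] FourierAlgebra G) (_ : IsMultiplicationBy f S),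
    cbOpNorm (VN G) S

variable (G) in
/-- The algebra `M_cb(A(G))` of completely bounded multipliers of `A(G)`. -/
def Mcb : Set (G → ℂ) := {f | cbNorm f < ∞}

/-- The closure of a set of functions on `G` in `M_cb(A(G))`, in the cb-multiplier norm. -/
def cbClosure (s : Set (G → ℂ)) : Set (G → ℂ) :=
  {f | f ∈ Mcb G ∧ ∀ ε : ℝ≥0∞, 0 < ε → ∃ g ∈ s, g ∈ Mcb G ∧ cbNorm (f - g) < ε}

variable (G) in
/-- `A_cb(G)`, the closure of `A(G)` in `M_cb(A(G))`. -/
def Acb : Set (G → ℂ) := cbClosure (Set.range (FourierAlgebra.toFun (G := G)))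

variable (G) in
/-- `G` is weakly amenable: `A_cb(G)` has a bounded approximate identity, i.e. there is a net
`(e_i)` in `A_cb(G)`, bounded in the cb-multiplier norm, with `‖f e_i - f‖_cb → 0` for all `f` in
the (commutative) algebra `A_cb(G)`. -/
def WeaklyAmenable : Prop :=
  ∃ (ι : Type u) (_ : Preorder ι) (_ : IsDirectedOrder ι) (_ : Nonempty ι)
    (e : ι → G → ℂ) (C : ℝ≥0),
    (∀ i, e i ∈ Acb G) ∧ (∀ i, cbNorm (e i) ≤ C) ∧
    ∀ f ∈ Acb G, Tendsto (fun i => cbNorm (f * e i - f)) atTop (𝓝 0)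

/-! ### Spectral synthesis -/

/-- `I(F)`: the elements of `A(G)` that vanish on `F`. -/
def idealI (F : Set G) : Set (FourierAlgebra G) :=
  {φ | ∀ x ∈ F, FourierAlgebra.toFun φ x = 0}

/-- The elements of `A(G)` whose support is compact and disjoint from `F`. -/
def compactlySupportedOff (F : Set G) : Set (FourierAlgebra G) :=
  {φ | HasCompactSupport (FourierAlgebra.toFun φ) ∧ Disjoint (tsupport (FourierAlgebra.toFun φ)) F}

/-- `J(F)`: the closure, in the norm of `A(G)`, of the set of the elements of `A(G)` whose support
is compact and disjoint from `F`. -/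
def idealJ (F : Set G) : Set (FourierAlgebra G) := closure (compactlySupportedOff F)

/-- `I_cb(F)`: the elements of `A_cb(G)` that vanish on `F`. -/
def idealIcb (F : Set G) : Set (G → ℂ) := {f | f ∈ Acb G ∧ ∀ x ∈ F, f x = 0}

/-- `J_cb(F)`: the closure, in the cb-multiplier norm, of the set of the elements of `A(G)` whose
support is compact and disjoint from `F`. -/
def idealJcb (F : Set G) : Set (G → ℂ) :=
  cbClosure (FourierAlgebra.toFun '' compactlySupportedOff F)

/-- A closed set `F` is a set of (spectral) synthesis for `A(G)`. -/
def IsSynthesisSet (F : Set G) : Prop := IsClosed F ∧ idealJ F = idealI F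

/-- A closed set `F` is a set of (spectral) synthesis for `A_cb(G)`. -/
def IsSynthesisSetCb (F : Set G) : Prop := IsClosed F ∧ idealJcb F = idealIcb F

end Group

end

end FourierAlg

/-! The inclusion of `idealJcb F` in `idealIcb F` holds because the cb-multiplier norm dominates the
supremum norm (`enorm_apply_le_cbNorm`): vanishing on `F` survives cb-limits. For the converse, let
`f` be in `idealIcb F`. Weak amenability gives `e i` with `f * e i` close to `f`; replacing `e i` by
a nearby `α` in A(G) gives `fα`, which lies in A(G), because `f` is a multiplier, and vanishes on
`F` (`WeaklyAmenable.exists_idealI_cbNorm_sub_lt`). Synthesis for A(G) approximates `fα` in the norm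
of A(G) by elements with compact support off `F`, and this approximation is also one in the cb-norm,
since `‖φ‖_cb ≤ ‖φ‖` on A(G) (`cbNorm_toFun_le`).

That contraction is the substantial part. It says that A(G) is a completely contractive algebra
under pointwise multiplication, and it comes from the comultiplication `Γ(T) = W*(1 ⊗ T)W` of VN(G),
where `(W(ξ ⊗ ζ))(t)(s) = ξ(s) ζ(st)`. Since `W` intertwines `λ(x) ⊗ λ(x)` with `1 ⊗ λ(x)`,
multiplication by `φ` is the preadjoint of `T ↦ (φ ⊗ id)Γ(T)`. The completely bounded norm of this
map is at most `‖φ‖` because the matrix coefficients of its amplifications are values of `φ` at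
single elements of controlled norm (`Comultiplication.norm_sum_slice_le`). The von Neumann tensor
product is never formed: slices of `Γ(T)` replace it, and a double commutant argument
(`inner_amp_eq_of_mem_generated`) carries identities from the `λ(x)` to all of VN(G). -/

namespace FourierAlg

noncomputable section

/-! ### Amplifications `1 ⊗ T` on `L²(α; H)` and the double commutant argument. -/

section Amplification

variable {H : Type u} [NormedAddCommGroup H] [InnerProductSpace ℂ H]
  {α : Type u} [MeasurableSpace α] {μ : Measure α}

variable (μ) in
/-- The amplification `1 ⊗ T` of an operator `T` on `H` to `L²(α; H)`. -/
def amp (T : H →L[ℂ] H) : Lp H 2 μ →L[ℂ] Lp H 2 μ := T.compLpL 2 μ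

theorem coeFn_amp (T : H →L[ℂ] H) (a : Lp H 2 μ) : amp μ T a =ᵐ[μ] fun t => T (a t) :=
  T.coeFn_compLpL a

theorem amp_add (S T : H →L[ℂ] H) : amp μ (S + T) = amp μ S + amp μ T :=
  ContinuousLinearMap.add_compLpL S T

theorem amp_smul (c : ℂ) (T : H →L[ℂ] H) : amp μ (c • T) = c • amp μ T :=
  ContinuousLinearMap.smul_compLpL c T

theorem amp_one : amp μ (1 : H →L[ℂ] H) = 1 := by
  ext1 a
  apply Lp.ext
  filter_upwards [coeFn_amp (μ := μ) (1 : H →L[ℂ] H) a] with t ht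
  simpa using ht

theorem amp_mul (S T : H →L[ℂ] H) : amp μ (S * T) = amp μ S * amp μ T := by
  ext1 a
  apply Lp.ext
  filter_upwards [coeFn_amp (S * T) a, coeFn_amp S (amp μ T a), coeFn_amp T a] with t h1 h2 h3
  rw [h1, mul_apply_eq_comp, mul_apply_eq_comp, h2, h3]

theorem norm_amp_le (T : H →L[ℂ] H) : ‖amp μ T‖ ≤ ‖T‖ := ContinuousLinearMap.norm_compLpL_le T

variable (μ) in
/-- The operator `h ↦ g ⊗ h` from `H` to `L²(α; H)`. -/
def tensorLeft (g : Lp ℂ 2 μ) : H →L[ℂ] Lp H 2 μ :=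
  ((ContinuousLinearMap.lsmul ℂ ℂ : ℂ →L[ℂ] H →L[ℂ] H).flip.compLpL₂ 2 μ).flip g

theorem coeFn_tensorLeft (g : Lp ℂ 2 μ) (h : H) :
    tensorLeft μ g h =ᵐ[μ] fun t => g t • h :=
  ((ContinuousLinearMap.lsmul ℂ ℂ : ℂ →L[ℂ] H →L[ℂ] H).flip h).coeFn_compLp g

theorem amp_tensorLeft (T : H →L[ℂ] H) (g : Lp ℂ 2 μ) (h : H) :
    amp μ T (tensorLeft μ g h) = tensorLeft μ g (T h) := by
  apply Lp.ext
  filter_upwards [coeFn_amp T (tensorLeft μ g h), coeFn_tensorLeft g h,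
    coeFn_tensorLeft g (T h)] with t h1 h2 h3
  rw [h1, h2, h3, map_smul]

theorem indicatorConstLp_eq_tensorLeft {s : Set α} (hs : MeasurableSet s) (hμ : μ s ≠ ∞) (h : H) :
    indicatorConstLp 2 hs hμ h = tensorLeft μ (indicatorConstLp 2 hs hμ (1 : ℂ)) h := by
  apply Lp.ext
  filter_upwards [indicatorConstLp_coeFn (p := 2) (hs := hs) (hμs := hμ) (c := h),
    indicatorConstLp_coeFn (p := 2) (hs := hs) (hμs := hμ) (c := (1 : ℂ)),
    coeFn_tensorLeft (indicatorConstLp 2 hs hμ (1 : ℂ)) h] with t h1 h2 h3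
  rw [h1, h3, h2]
  by_cases ht : t ∈ s <;> simp [ht]

/-- The elementary tensors are total in `L²(α; H)`. -/
theorem Lp_induction_tensor {p : Lp H 2 μ → Prop} (ht : ∀ g h, p (tensorLeft μ g h))
    (hadd : ∀ a b, p a → p b → p (a + b)) (hcl : IsClosed {a | p a}) (a : Lp H 2 μ) : p a := by
  refine Lp.induction (by simp) p ?_ ?_ hcl a
  · intro c s hs hμs
    have := ht (indicatorConstLp 2 hs hμs.ne (1 : ℂ)) c
    rw [← indicatorConstLp_eq_tensorLeft] at this
    exact this
  · intro f g hf hg _ h1 h2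
    exact hadd _ _ h1 h2

variable [CompleteSpace H]

theorem inner_amp_left (T : H →L[ℂ] H) (a b : Lp H 2 μ) :
    ⟪amp μ T a, b⟫_ℂ = ⟪a, amp μ (star T) b⟫_ℂ := by
  rw [L2.inner_def, L2.inner_def]
  apply integral_congr_ae
  filter_upwards [coeFn_amp T a, coeFn_amp (star T) b] with t h1 h2
  rw [h1, h2, ContinuousLinearMap.star_eq_adjoint, ContinuousLinearMap.adjoint_inner_right]

theorem mem_generated_iff {s : Set (H →L[ℂ] H)} {T : H →L[ℂ] H} :
    T ∈ (generated s).toStarSubalgebra ↔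
      ∀ S : H →L[ℂ] H, (∀ R ∈ s, R * S = S * R ∧ star R * S = S * star R) → S * T = T * S := by
  have h0 : T ∈ (generated s).toStarSubalgebra ↔ T ∈ StarSubalgebra.centralizer ℂ
    (StarSubalgebra.centralizer ℂ s : Set (H →L[ℂ] H)) := Iff.rfl
  rw [h0, StarSubalgebra.mem_centralizer_iff]
  constructor
  · intro h S hS
    exact (h S ((StarSubalgebra.mem_centralizer_iff ℂ).2 hS)).1
  · intro h S hS
    exact ⟨h S ((StarSubalgebra.mem_centralizer_iff ℂ).1 hS),
      h _ ((StarSubalgebra.mem_centralizer_iff ℂ).1 (star_mem hS))⟩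

/-- An operator on `L²(α; H)` which commutes with `1 ⊗ R` and `1 ⊗ R*` for all `R ∈ s` commutes
with `1 ⊗ T` for all `T` in the von Neumann algebra generated by `s`. -/
theorem commute_amp_of_mem_generated {s : Set (H →L[ℂ] H)} {T : H →L[ℂ] H}
    (hT : T ∈ (generated s).toStarSubalgebra) {X : Lp H 2 μ →L[ℂ] Lp H 2 μ}
    (hX : ∀ R ∈ s, Commute (amp μ R) X ∧ Commute (amp μ (star R)) X) :
    Commute (amp μ T) X := by
  have key : ∀ (g g' : Lp ℂ 2 μ) (h k : H),
      ⟪amp μ T (X (tensorLeft μ g h)), tensorLeft μ g' k⟫_ℂ =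
        ⟪X (amp μ T (tensorLeft μ g h)), tensorLeft μ g' k⟫_ℂ := by
    intro g g' h k
    -- The "matrix entry" of `X` at `(g', g)`. It commutes with `s` and its adjoints, hence with
    -- `T`, and elementary tensors determine an operator on `L²(α; H)`.
    set Y : H →L[ℂ] H := (tensorLeft μ g').adjoint ∘L X ∘L tensorLeft μ g with hY
    have hYi : ∀ u v : H, ⟪Y u, v⟫_ℂ = ⟪X (tensorLeft μ g u), tensorLeft μ g' v⟫_ℂ := by
      intro u v
      simp [hY, ContinuousLinearMap.adjoint_inner_left]
    have comm : ∀ R : H →L[ℂ] H, Commute (amp μ R) X → R * Y = Y * R := by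
      intro R hR
      ext1 u
      refine ext_inner_right ℂ fun v => ?_
      rw [mul_apply_eq_comp, mul_apply_eq_comp,
        ← ContinuousLinearMap.adjoint_inner_right, hYi, hYi, ← ContinuousLinearMap.star_eq_adjoint,
        ← amp_tensorLeft, ← inner_amp_left, ← amp_tensorLeft]
      exact congrArg (fun Z : Lp H 2 μ →L[ℂ] Lp H 2 μ =>
        ⟪Z (tensorLeft μ g u), tensorLeft μ g' v⟫_ℂ) hR.eq
    have hYT := mem_generated_iff.1 hT Y fun R hR => ⟨comm R (hX R hR).1, comm _ (hX R hR).2⟩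
    rw [inner_amp_left, amp_tensorLeft, amp_tensorLeft, ← hYi, ← hYi,
      ContinuousLinearMap.star_eq_adjoint, ContinuousLinearMap.adjoint_inner_right]
    exact congrArg (fun Z : H →L[ℂ] H => ⟪Z h, k⟫_ℂ) hYT.symm
  refine ContinuousLinearMap.ext fun a => ?_
  rw [mul_apply_eq_comp, mul_apply_eq_comp]
  refine Lp_induction_tensor (p := fun a => amp μ T (X a) = X (amp μ T a))
    (fun g h => ?_) (fun a b ha hb => ?_) ?_ a
  · refine ext_inner_right ℂ fun b => ?_
    refine Lp_induction_tensor (p := fun b => ⟪amp μ T (X (tensorLeft μ g h)), b⟫_ℂ =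
        ⟪X (amp μ T (tensorLeft μ g h)), b⟫_ℂ) (fun g' k => key g g' h k) (fun a b ha hb => ?_) ?_ b
    · rw [inner_add_right, inner_add_right, ha, hb]
    · exact isClosed_eq (by fun_prop) (by fun_prop)
  · simp only [map_add, ha, hb]
  · exact isClosed_eq (by fun_prop) (by fun_prop)

/-- If `⟪(1 ⊗ R) a, b⟫ = ⟪(1 ⊗ R) a', b'⟫` for all `R` in a self-adjoint semigroup containing `1`,
then this holds for the von Neumann algebra generated by it as well. -/
theorem inner_amp_eq_of_mem_generated {s : Set (H →L[ℂ] H)} (h1 : 1 ∈ s)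
    (hstar : ∀ R ∈ s, star R ∈ s) (hmul : ∀ R ∈ s, ∀ S ∈ s, R * S ∈ s) {T : H →L[ℂ] H}
    (hT : T ∈ (generated s).toStarSubalgebra) {a b a' b' : Lp H 2 μ}
    (h : ∀ R ∈ s, ⟪b, amp μ R a⟫_ℂ = ⟪b', amp μ R a'⟫_ℂ) :
    ⟪b, amp μ T a⟫_ℂ = ⟪b', amp μ T a'⟫_ℂ := by
  -- Both sides are put into one inner product on the doubled space: with `v = (a, a')` and `w = (b,
  -- -b')`, the hypothesis says that `w` is orthogonal to every `D R v`, and the goal is `w ⟂ D T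
  -- v`. As in the double commutant theorem, it suffices that `D T v` lies in the cyclic subspace
  -- `U` generated by `v`.
  let K := WithLp 2 (Lp H 2 μ × Lp H 2 μ)
  let e : K ≃L[ℂ] (Lp H 2 μ × Lp H 2 μ) := WithLp.prodContinuousLinearEquiv 2 ℂ _ _
  let D : (H →L[ℂ] H) → (K →L[ℂ] K) := fun R =>
    (e.symm : (Lp H 2 μ × Lp H 2 μ) →L[ℂ] K) ∘L ((amp μ R).prodMap (amp μ R)) ∘L (e : K →L[ℂ] (Lp H 2 μ × Lp H 2 μ))
  have hDinner : ∀ R (x y : K), ⟪D R x, y⟫_ℂ = ⟪x, D (star R) y⟫_ℂ := by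
    intro R x y
    exact congrArg₂ (· + ·) (inner_amp_left R x.fst y.fst) (inner_amp_left R x.snd y.snd)
  let v : K := WithLp.toLp 2 (a, a')
  let w : K := WithLp.toLp 2 (b, -b')
  let U : Submodule ℂ K := (Submodule.span ℂ ((fun R => D R v) '' s)).topologicalClosure
  have hUmem : ∀ R ∈ s, D R v ∈ U := fun R hR =>
    Submodule.le_topologicalClosure _ (Submodule.subset_span ⟨R, hR, rfl⟩)
  have hUinv : ∀ R ∈ s, ∀ x ∈ U, D R x ∈ U := by
    intro R hR
    have hle : U ≤ U.comap (D R : K →ₗ[ℂ] K) := by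
      refine Submodule.topologicalClosure_minimal _ (Submodule.span_le.2 ?_) ?_
      · rintro _ ⟨S, hS, rfl⟩
        have : D R (D S v) = D (R * S) v := by
          simp only [D, amp_mul]
          rfl
        show D R (D S v) ∈ U
        rw [this]
        exact hUmem _ (hmul R hR S hS)
      · exact (Submodule.isClosed_topologicalClosure _).preimage (D R).continuous
    exact fun x hx => hle hx
  have : CompleteSpace U := (Submodule.isClosed_topologicalClosure _).completeSpace_coe
  let P : K →L[ℂ] K := U.starProjection
  -- Since `s` is self-adjoint, both `U` and its orthogonal complement are invariant under `D R`, so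
  -- `D R` commutes with the projection.
  have hPD : ∀ R ∈ s, D R ∘L P = P ∘L D R := by
    intro R hR
    ext1 x
    have hx : x = P x + (x - P x) := by abel
    have h2 : D R (x - P x) ∈ Uᗮ := by
      intro y hy
      rw [← inner_conj_symm, hDinner, inner_conj_symm]
      exact U.sub_starProjection_mem_orthogonal x _ (hUinv _ (hstar R hR) y hy)
    show D R (P x) = P (D R x)
    conv_rhs => rw [hx, map_add, map_add]
    rw [show P (D R (x - P x)) = 0 from (Submodule.starProjection_apply_eq_zero_iff U).2 h2,
      add_zero]
    exact (Submodule.starProjection_eq_self_iff.2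
      (hUinv R hR _ (Submodule.starProjection_apply_mem U x))).symm
  -- The commutation lemma applies to operators on `L²(α; H)`, not on its double, so it is applied
  -- to each of the four entries of `P`.
  have hentry : ∀ (p : K →L[ℂ] Lp H 2 μ) (j : Lp H 2 μ →L[ℂ] K),
      (∀ R x, p (D R x) = amp μ R (p x)) → (∀ R x, j (amp μ R x) = D R (j x)) →
      ∀ x, amp μ T (p (P (j x))) = p (P (j (amp μ T x))) := by
    intro p j hp hj
    have hcomm : ∀ R ∈ s, Commute (amp μ R) (p ∘L P ∘L j) := by
      intro R hR
      refine ContinuousLinearMap.ext fun x => ?_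
      show amp μ R (p (P (j x))) = p (P (j (amp μ R x)))
      rw [hj, ← hp]
      exact congrArg (fun Z : K →L[ℂ] K => p (Z (j x))) (hPD R hR)
    have := commute_amp_of_mem_generated hT
      (fun R hR => ⟨hcomm R hR, hcomm _ (hstar R hR)⟩)
    exact fun x => congrArg (fun Z : Lp H 2 μ →L[ℂ] Lp H 2 μ => Z x) this.eq
  let p₁ : K →L[ℂ] Lp H 2 μ := ContinuousLinearMap.fst ℂ _ _ ∘L (e : K →L[ℂ] (Lp H 2 μ × Lp H 2 μ))
  let p₂ : K →L[ℂ] Lp H 2 μ := ContinuousLinearMap.snd ℂ _ _ ∘L (e : K →L[ℂ] (Lp H 2 μ × Lp H 2 μ))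
  let j₁ : Lp H 2 μ →L[ℂ] K := (e.symm : (Lp H 2 μ × Lp H 2 μ) →L[ℂ] K) ∘L ContinuousLinearMap.inl ℂ _ _
  let j₂ : Lp H 2 μ →L[ℂ] K := (e.symm : (Lp H 2 μ × Lp H 2 μ) →L[ℂ] K) ∘L ContinuousLinearMap.inr ℂ _ _
  have hp₁ : ∀ R x, p₁ (D R x) = amp μ R (p₁ x) := fun R x => rfl
  have hp₂ : ∀ R x, p₂ (D R x) = amp μ R (p₂ x) := fun R x => rfl
  have hext : ∀ x y : K, p₁ x = p₁ y → p₂ x = p₂ y → x = y :=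
    fun x y h h' => e.injective (Prod.ext h h')
  have hj₁ : ∀ R x, j₁ (amp μ R x) = D R (j₁ x) := by
    intro R x
    exact hext _ _ rfl (map_zero (amp μ R)).symm
  have hj₂ : ∀ R x, j₂ (amp μ R x) = D R (j₂ x) := by
    intro R x
    exact hext _ _ (map_zero (amp μ R)).symm rfl
  have hsum : ∀ x, x = j₁ (p₁ x) + j₂ (p₂ x) := fun x =>
    hext _ _ (add_zero (p₁ x)).symm (zero_add (p₂ x)).symm
  have hDT : ∀ x, D T (P x) = P (D T x) := by
    intro x
    refine hext _ _ ?_ ?_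
    · rw [hp₁, hsum x]
      simp only [map_add]
      rw [hentry p₁ j₁ hp₁ hj₁, hentry p₁ j₂ hp₁ hj₂, hj₁, hj₂]
    · rw [hp₂, hsum x]
      simp only [map_add]
      rw [hentry p₂ j₁ hp₂ hj₁, hentry p₂ j₂ hp₂ hj₂, hj₁, hj₂]
  -- Here `1 ∈ s` is needed: it puts `v` itself in `U`.
  have hTv : D T v ∈ U := by
    have hv : P v = v := Submodule.starProjection_eq_self_iff.2 (by
      have := hUmem 1 h1
      have h2 : D 1 v = v := by simp only [D, amp_one]; rfl
      rwa [h2] at this)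
    rw [← hv, hDT]
    exact Submodule.starProjection_apply_mem U _
  have hw : w ∈ Uᗮ := by
    have hle : U ≤ (ℂ ∙ w)ᗮ := by
      refine Submodule.topologicalClosure_minimal _ (Submodule.span_le.2 ?_)
        (Submodule.isClosed_orthogonal _)
      rintro _ ⟨R, hR, rfl⟩
      refine Submodule.mem_orthogonal_singleton_iff_inner_right.2 ?_
      show ⟪b, amp μ R a⟫_ℂ + ⟪-b', amp μ R a'⟫_ℂ = 0
      rw [inner_neg_left, h R hR, add_neg_cancel]
    intro y hy
    rw [← inner_conj_symm, Submodule.mem_orthogonal_singleton_iff_inner_right.1 (hle hy), map_zero]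
  have h0 : ⟪w, D T v⟫_ℂ = 0 := by rw [← inner_conj_symm, hw _ hTv, map_zero]
  have h0' : ⟪b, amp μ T a⟫_ℂ + ⟪-b', amp μ T a'⟫_ℂ = 0 := h0
  rwa [inner_neg_left, add_neg_eq_zero] at h0'

end Amplification

/-! ### Matrix norms and normality of the amplification. -/

section NormalFunctionals

variable {H : Type u} [NormedAddCommGroup H] [InnerProductSpace ℂ H]
  {α : Type u} [MeasurableSpace α] {μ : Measure α}

theorem inner_tensorLeft (g g' : Lp ℂ 2 μ) (h h' : H) :
    ⟪tensorLeft μ g' h', tensorLeft μ g h⟫_ℂ = ⟪g', g⟫_ℂ * ⟪h', h⟫_ℂ := by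
  rw [L2.inner_def, L2.inner_def, ← integral_mul_const]
  apply integral_congr_ae
  filter_upwards [coeFn_tensorLeft g h, coeFn_tensorLeft g' h'] with t h1 h2
  rw [h1, h2, inner_smul_left, inner_smul_right]
  simp
  ring

theorem Lp_norm_sq_eq_integral (a : Lp H 2 μ) : ‖a‖ ^ 2 = ∫ t, ‖a t‖ ^ 2 ∂μ := by
  have h : ((‖a‖ ^ 2 : ℝ) : ℂ) = ((∫ t, ‖a t‖ ^ 2 ∂μ : ℝ) : ℂ) := by
    rw [← integral_complex_ofReal]
    have := L2.inner_def (𝕜 := ℂ) a a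
    rw [inner_self_eq_norm_sq_to_K] at this
    push_cast
    rw [← Complex.coe_algebraMap] at *
    simpa [inner_self_eq_norm_sq_to_K] using this
  exact_mod_cast h

omit [InnerProductSpace ℂ H] in
theorem Lp_integrable_norm_sq (a : Lp H 2 μ) : Integrable (fun t => ‖a t‖ ^ 2) μ :=
  (Lp.memLp a).integrable_norm_pow (by norm_num)

theorem matrixOp_apply {m : ℕ} (T : Matrix (Fin m) (Fin m) (H →L[ℂ] H))
    (x : PiLp 2 fun _ : Fin m => H) (k : Fin m) : matrixOp T x k = ∑ l, T k l (x l) := by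
  simp [matrixOp]

/-- The amplified matrix acts pointwise in `t` as the matrix `T` itself, so the bound is the
pointwise one, squared and integrated. -/
theorem norm_matrixOp_amp_le {m : ℕ} (T : Matrix (Fin m) (Fin m) (H →L[ℂ] H)) :
    ‖matrixOp (T.map (amp μ))‖ ≤ ‖matrixOp T‖ := by
  refine ContinuousLinearMap.opNorm_le_bound _ (norm_nonneg (matrixOp T)) fun u => ?_
  refine le_of_sq_le_sq ?_ (by positivity)
  have hae : ∀ᵐ t ∂μ, ∀ k, (matrixOp (T.map (amp μ)) u k : Lp H 2 μ) t = ∑ l, T k l (u l t) := by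
    refine ae_all_iff.2 fun k => ?_
    rw [matrixOp_apply]
    have h1 : ∀ᵐ t ∂μ, ∀ l, (amp μ (T k l) (u l)) t = T k l (u l t) :=
      ae_all_iff.2 fun l => coeFn_amp _ _
    filter_upwards [h1, Lp.coeFn_fun_finsetSum Finset.univ (fun l => amp μ (T k l) (u l))]
      with t h1 h2
    simp only [Matrix.map_apply]
    rw [h2]
    exact Finset.sum_congr rfl fun l _ => h1 l
  rw [mul_pow, PiLp.norm_sq_eq_of_L2, PiLp.norm_sq_eq_of_L2]
  simp only [Lp_norm_sq_eq_integral]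
  rw [← integral_finsetSum _ fun k _ => Lp_integrable_norm_sq _,
    ← integral_finsetSum _ fun k _ => Lp_integrable_norm_sq _, ← integral_const_mul]
  refine integral_mono_ae (integrable_finsetSum _ fun k _ => Lp_integrable_norm_sq _)
    ((integrable_finsetSum _ fun k _ => Lp_integrable_norm_sq _).const_mul _) ?_
  filter_upwards [hae] with t ht
  simp only [ht]
  have := (matrixOp T).le_opNorm (WithLp.toLp 2 fun l => u l t)
  have h2 := pow_le_pow_left₀ (norm_nonneg _) this 2
  rw [mul_pow, PiLp.norm_sq_eq_of_L2, PiLp.norm_sq_eq_of_L2] at h2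
  simpa only [matrixOp_apply] using h2

variable [CompleteSpace H] (M : VonNeumannAlgebra H)

variable (μ) in
/-- The amplification `T ↦ 1 ⊗ T` on a von Neumann algebra. -/
def ampL : Elem M →L[ℂ] (Lp H 2 μ →L[ℂ] Lp H 2 μ) :=
  LinearMap.mkContinuous
    { toFun := fun T => amp μ (T : H →L[ℂ] H)
      map_add' := fun S T => amp_add _ _
      map_smul' := fun c T => amp_smul _ _ } 1
    (fun T => by
      rw [one_mul]
      exact norm_amp_le _)

/-- The functional `T ↦ ⟪(1 ⊗ T) a, b⟫`. -/
def ampFunctional (a b : Lp H 2 μ) : StrongDual ℂ (Elem M) :=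
  innerSL ℂ b ∘L (ampL μ M).flip a

theorem ampFunctional_apply (a b : Lp H 2 μ) (T : Elem M) :
    ampFunctional M a b T = ⟪b, amp μ (T : H →L[ℂ] H) a⟫_ℂ := rfl

theorem vectorFunctional_apply (ξ η : H) (T : Elem M) :
    vectorFunctional M ξ η T = ⟪η, (T : H →L[ℂ] H) ξ⟫_ℂ := rfl

theorem vectorFunctional_mem (ξ η : H) : vectorFunctional M ξ η ∈ predual M :=
  Submodule.le_topologicalClosure _ (Submodule.subset_span ⟨ξ, η, rfl⟩)

theorem isClosed_predual : IsClosed (predual M : Set (StrongDual ℂ (Elem M))) :=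
  Submodule.isClosed_topologicalClosure _

/-- A continuous linear map sends the predual into a closed subspace if it does so for the vector
functionals. -/
theorem mem_of_vectorFunctional_mem {E : Type*} [NormedAddCommGroup E] [NormedSpace ℂ E]
    (L : StrongDual ℂ (Elem M) →L[ℂ] E) {V : Submodule ℂ E} (hV : IsClosed (V : Set E))
    (h : ∀ ξ η, L (vectorFunctional M ξ η) ∈ V) {φ : StrongDual ℂ (Elem M)}
    (hφ : φ ∈ predual M) : L φ ∈ V := by
  have hle : predual M ≤ V.comap (L : StrongDual ℂ (Elem M) →ₗ[ℂ] E) := by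
    refine Submodule.topologicalClosure_minimal _ (Submodule.span_le.2 ?_)
      (hV.preimage L.continuous)
    rintro _ ⟨ξ, η, rfl⟩
    exact h ξ η
  exact hle hφ

/-- Normality of `T ↦ 1 ⊗ T`. For elementary tensors the functional is a scalar multiple of a vector
functional; totality and closedness of the predual give the rest. -/
theorem ampFunctional_mem (a b : Lp H 2 μ) : ampFunctional M a b ∈ predual M := by
  refine Lp_induction_tensor (p := fun a => ampFunctional M a b ∈ predual M)
    (fun g h => ?_) (fun a a' h h' => ?_) ?_ a
  · refine Lp_induction_tensor
      (p := fun b => ampFunctional M (tensorLeft μ g h) b ∈ predual M)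
      (fun g' h' => ?_) (fun a a' h h' => ?_) ?_ b
    · have : ampFunctional M (tensorLeft μ g h) (tensorLeft μ g' h') =
          ⟪g', g⟫_ℂ • vectorFunctional M h h' := by
        ext T
        rw [ampFunctional_apply, amp_tensorLeft, inner_tensorLeft]
        rfl
      rw [this]
      exact Submodule.smul_mem _ _ (vectorFunctional_mem M h h')
    · have := add_mem h h'
      simpa [ampFunctional] using this
    · exact (isClosed_predual M).preimage (by unfold ampFunctional; fun_prop)
  · have := add_mem h h'
    simpa [ampFunctional] using this
  · exact (isClosed_predual M).preimage (by unfold ampFunctional; fun_prop)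

end NormalFunctionals

/-! ### The abstract comultiplication and the multiplication it induces on the predual. -/

section Comultiplication

variable {H : Type u} [NormedAddCommGroup H] [InnerProductSpace ℂ H] [CompleteSpace H]
  {α : Type u} [MeasurableSpace α]

theorem opNorm_le_of_norm_inner_le {E F : Type*} [NormedAddCommGroup E] [InnerProductSpace ℂ E]
    [NormedAddCommGroup F] [InnerProductSpace ℂ F] {T : E →L[ℂ] F} {C : ℝ} (hC : 0 ≤ C)
    (h : ∀ x y, ‖⟪y, T x⟫_ℂ‖ ≤ C * ‖x‖ * ‖y‖) : ‖T‖ ≤ C := by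
  refine ContinuousLinearMap.opNorm_le_of_re_inner_le (𝕜 := ℂ) hC fun x y hx hy => ?_
  refine (Complex.re_le_norm _).trans ?_
  have := h x y
  rwa [hx, hy, mul_one, mul_one, norm_inner_symm] at this

theorem Elem.norm_le_of_norm_inner_le {M : VonNeumannAlgebra H} {T : Elem M} {C : ℝ} (hC : 0 ≤ C)
    (h : ∀ ξ η : H, ‖⟪η, (T : H →L[ℂ] H) ξ⟫_ℂ‖ ≤ C * ‖ξ‖ * ‖η‖) : ‖T‖ ≤ C :=
  opNorm_le_of_norm_inner_le hC h

theorem Elem.ext_inner {M : VonNeumannAlgebra H} {S T : Elem M}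
    (h : ∀ ξ η : H, ⟪η, (S : H →L[ℂ] H) ξ⟫_ℂ = ⟪η, (T : H →L[ℂ] H) ξ⟫_ℂ) : S = T :=
  Subtype.ext (ContinuousLinearMap.ext fun ξ => ext_inner_left ℂ (h ξ))

omit [CompleteSpace H] in
theorem matrixOp_smul {m : ℕ} (c : ℂ) (T : Matrix (Fin m) (Fin m) (H →L[ℂ] H)) :
    matrixOp (c • T) = c • matrixOp T := by
  ext x k
  simp [matrixOp_apply, Finset.smul_sum]

/-- An isometry `W : H ⊗ H → L²(α; H)` with `W (R ⊗ R) = (1 ⊗ R) W` for all `R` in a self-adjoint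
semigroup `s` of operators; it induces the comultiplication `R ↦ R ⊗ R` of the von Neumann algebra
generated by `s`. -/
structure Comultiplication (s : Set (H →L[ℂ] H)) (μ : Measure α) where
  /-- The isometry, as a bilinear map. -/
  W : H →L[ℂ] H →L[ℂ] Lp H 2 μ
  inner_W : ∀ ξ ζ η θ, ⟪W ξ ζ, W η θ⟫_ℂ = ⟪ξ, η⟫_ℂ * ⟪ζ, θ⟫_ℂ
  amp_W : ∀ R ∈ s, ∀ ξ ζ, amp μ R (W ξ ζ) = W (R ξ) (R ζ)
  one_mem : 1 ∈ s
  star_mem : ∀ R ∈ s, star R ∈ s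
  mul_mem : ∀ R ∈ s, ∀ S ∈ s, R * S ∈ s

namespace Comultiplication

variable {s : Set (H →L[ℂ] H)} {μ : Measure α} (Γ : Comultiplication s μ)

theorem norm_W (ξ ζ : H) : ‖Γ.W ξ ζ‖ = ‖ξ‖ * ‖ζ‖ := by
  have h := Γ.inner_W ξ ζ ξ ζ
  simp only [inner_self_eq_norm_sq_to_K] at h
  have h2 : ‖Γ.W ξ ζ‖ ^ 2 = (‖ξ‖ * ‖ζ‖) ^ 2 := by
    rw [mul_pow]
    exact_mod_cast h
  exact (sq_eq_sq₀ (norm_nonneg _) (by positivity)).1 h2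

/-- The operator `T ↦ (id ⊗ ω) (Γ T)` on `H`, with `ω` the vector functional of `ζ` and `θ`. -/
def sliceOp (T : H →L[ℂ] H) (ζ θ : H) : H →L[ℂ] H :=
  (Γ.W.flip θ).adjoint ∘L amp μ T ∘L Γ.W.flip ζ

theorem inner_sliceOp (T : H →L[ℂ] H) (ζ θ ξ η : H) :
    ⟪η, Γ.sliceOp T ζ θ ξ⟫_ℂ = ⟪Γ.W η θ, amp μ T (Γ.W ξ ζ)⟫_ℂ := by
  simp [sliceOp, ContinuousLinearMap.adjoint_inner_right]

theorem sliceOp_of_mem {R : H →L[ℂ] H} (hR : R ∈ s) (ζ θ : H) :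
    Γ.sliceOp R ζ θ = ⟪θ, R ζ⟫_ℂ • R := by
  ext1 ξ
  refine ext_inner_left ℂ fun η => ?_
  rw [inner_sliceOp, Γ.amp_W R hR, Γ.inner_W, smul_apply, inner_smul_right,
    mul_comm]

variable {T : H →L[ℂ] H}

/-- For `R ∈ s` the slice is a multiple of `R` and commutes with each `S` in the commutant. Tested
on vectors, this is an equality of two coefficients of `1 ⊗ R`, which passes to `T`. -/
theorem sliceOp_mem (hT : T ∈ (generated s).toStarSubalgebra) (ζ θ : H) :
    Γ.sliceOp T ζ θ ∈ (generated s).toStarSubalgebra := by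
  refine mem_generated_iff.2 fun S hS => ?_
  ext1 ξ
  refine ext_inner_left ℂ fun η => ?_
  rw [mul_apply_eq_comp, mul_apply_eq_comp, ← ContinuousLinearMap.adjoint_inner_left,
    inner_sliceOp, inner_sliceOp]
  refine inner_amp_eq_of_mem_generated Γ.one_mem Γ.star_mem Γ.mul_mem hT fun R hR => ?_
  rw [Γ.amp_W R hR, Γ.amp_W R hR, Γ.inner_W, Γ.inner_W, ContinuousLinearMap.adjoint_inner_left]
  exact congrArg (fun Z : H →L[ℂ] H => ⟪η, Z ξ⟫_ℂ * ⟪θ, R ζ⟫_ℂ) (hS R hR).1.symm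

/-- This expresses that `Γ(T)` commutes with `1 ⊗ S` for `S` in the commutant, the second-leg
counterpart of `sliceOp_mem`; it is what puts `(φ ⊗ id)Γ(T)` back in the algebra. -/
theorem sliceOp_commute (hT : T ∈ (generated s).toStarSubalgebra) {S : H →L[ℂ] H}
    (hS : ∀ R ∈ s, R * S = S * R ∧ star R * S = S * star R) (ζ θ : H) :
    Γ.sliceOp T (S ζ) θ = Γ.sliceOp T ζ (S.adjoint θ) := by
  ext1 ξ
  refine ext_inner_left ℂ fun η => ?_
  rw [inner_sliceOp, inner_sliceOp]
  refine inner_amp_eq_of_mem_generated Γ.one_mem Γ.star_mem Γ.mul_mem hT fun R hR => ?_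
  rw [Γ.amp_W R hR, Γ.amp_W R hR, Γ.inner_W, Γ.inner_W, ContinuousLinearMap.adjoint_inner_left]
  exact congrArg (fun Z : H →L[ℂ] H => ⟪η, R ξ⟫_ℂ * ⟪θ, Z ζ⟫_ℂ) (hS R hR).1

/-- `Comultiplication.sliceOp` as an operation on the von Neumann algebra generated by `s`. -/
def slice (T : Elem (generated s)) (ζ θ : H) : Elem (generated s) :=
  ⟨Γ.sliceOp T ζ θ, Γ.sliceOp_mem T.2 ζ θ⟩

theorem inner_slice (T : Elem (generated s)) (ζ θ ξ η : H) :
    ⟪η, (Γ.slice T ζ θ : H →L[ℂ] H) ξ⟫_ℂ = ⟪Γ.W η θ, ampL μ _ T (Γ.W ξ ζ)⟫_ℂ :=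
  Γ.inner_sliceOp _ _ _ _ _

theorem slice_add (S T : Elem (generated s)) (ζ θ : H) :
    Γ.slice (S + T) ζ θ = Γ.slice S ζ θ + Γ.slice T ζ θ := by
  refine Elem.ext_inner fun ξ η => ?_
  rw [inner_slice, map_add]
  show _ = ⟪η, (Γ.slice S ζ θ : H →L[ℂ] H) ξ + (Γ.slice T ζ θ : H →L[ℂ] H) ξ⟫_ℂ
  rw [inner_add_right, inner_slice, inner_slice, add_apply, inner_add_right]

theorem slice_smul (c : ℂ) (T : Elem (generated s)) (ζ θ : H) :
    Γ.slice (c • T) ζ θ = c • Γ.slice T ζ θ := by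
  refine Elem.ext_inner fun ξ η => ?_
  rw [inner_slice, map_smul]
  show _ = ⟪η, c • (Γ.slice T ζ θ : H →L[ℂ] H) ξ⟫_ℂ
  rw [inner_smul_right, inner_slice, smul_apply, inner_smul_right]

theorem slice_add_left (T : Elem (generated s)) (ζ ζ' θ : H) :
    Γ.slice T (ζ + ζ') θ = Γ.slice T ζ θ + Γ.slice T ζ' θ := by
  refine Elem.ext_inner fun ξ η => ?_
  rw [inner_slice, map_add, map_add]
  show _ = ⟪η, (Γ.slice T ζ θ : H →L[ℂ] H) ξ + (Γ.slice T ζ' θ : H →L[ℂ] H) ξ⟫_ℂ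
  rw [inner_add_right, inner_add_right, inner_slice, inner_slice]

theorem slice_smul_left (c : ℂ) (T : Elem (generated s)) (ζ θ : H) :
    Γ.slice T (c • ζ) θ = c • Γ.slice T ζ θ := by
  refine Elem.ext_inner fun ξ η => ?_
  rw [inner_slice, map_smul, map_smul]
  show _ = ⟪η, c • (Γ.slice T ζ θ : H →L[ℂ] H) ξ⟫_ℂ
  rw [inner_smul_right, inner_smul_right, inner_slice]

theorem slice_add_right (T : Elem (generated s)) (ζ θ θ' : H) :
    Γ.slice T ζ (θ + θ') = Γ.slice T ζ θ + Γ.slice T ζ θ' := by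
  refine Elem.ext_inner fun ξ η => ?_
  rw [inner_slice, map_add, inner_add_left]
  show _ = ⟪η, (Γ.slice T ζ θ : H →L[ℂ] H) ξ + (Γ.slice T ζ θ' : H →L[ℂ] H) ξ⟫_ℂ
  rw [inner_add_right, inner_slice, inner_slice]

theorem slice_smul_right (c : ℂ) (T : Elem (generated s)) (ζ θ : H) :
    Γ.slice T ζ (c • θ) = starRingEnd ℂ c • Γ.slice T ζ θ := by
  refine Elem.ext_inner fun ξ η => ?_
  rw [inner_slice, map_smul, inner_smul_left]
  show _ = ⟪η, starRingEnd ℂ c • (Γ.slice T ζ θ : H →L[ℂ] H) ξ⟫_ℂ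
  rw [inner_smul_right, inner_slice]

/-- Complete contractivity of `Γ`. A coefficient of the whole sum is one coefficient of the
amplified matrix, between the vectors `(W η (w k))ₖ` and `(W ξ (z l))ₗ`, of norms `‖η‖ ‖w‖` and `‖ξ‖
‖z‖`. -/
theorem norm_sum_slice_le {m : ℕ} (T : Matrix (Fin m) (Fin m) (Elem (generated s)))
    (z w : PiLp 2 fun _ : Fin m => H) :
    ‖∑ k, ∑ l, Γ.slice (T k l) (z l) (w k)‖ ≤
      ‖matrixOp (T.map (fun t => (t : H →L[ℂ] H)))‖ * ‖z‖ * ‖w‖ := by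
  set N := ‖matrixOp (T.map (fun t => (t : H →L[ℂ] H)))‖
  have hcoe : ∀ ξ η : H, ⟪η, ((∑ k, ∑ l, Γ.slice (T k l) (z l) (w k) : Elem (generated s)) :
      H →L[ℂ] H) ξ⟫_ℂ = ∑ k, ∑ l, ⟪Γ.W η (w k), ampL μ _ (T k l) (Γ.W ξ (z l))⟫_ℂ := by
    intro ξ η
    have : ((∑ k, ∑ l, Γ.slice (T k l) (z l) (w k) : Elem (generated s)) : H →L[ℂ] H) =
        ∑ k, ∑ l, (Γ.slice (T k l) (z l) (w k) : H →L[ℂ] H) := by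
      simp only [AddSubmonoidClass.coe_finsetSum]
    rw [this]
    simp only [sum_apply, inner_sum, inner_slice]
  have hnorm : ∀ (ξ : H) (v : PiLp 2 fun _ : Fin m => H),
      ‖(WithLp.toLp 2 fun l => Γ.W ξ (v l) : PiLp 2 fun _ : Fin m => Lp H 2 μ)‖ = ‖ξ‖ * ‖v‖ := by
    intro ξ v
    refine (sq_eq_sq₀ (norm_nonneg _) (by positivity)).1 ?_
    rw [mul_pow, PiLp.norm_sq_eq_of_L2, PiLp.norm_sq_eq_of_L2, Finset.mul_sum]
    exact Finset.sum_congr rfl fun l _ => by simp only [Γ.norm_W, mul_pow]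
  refine Elem.norm_le_of_norm_inner_le (by positivity) fun ξ η => ?_
  have hle := (matrixOp ((T.map (fun t => (t : H →L[ℂ] H))).map (amp μ))).le_opNorm
    (WithLp.toLp 2 fun l => Γ.W ξ (z l))
  have hin := norm_inner_le_norm (𝕜 := ℂ)
    (WithLp.toLp 2 fun l => Γ.W η (w l) : PiLp 2 fun _ : Fin m => Lp H 2 μ)
    (matrixOp ((T.map (fun t => (t : H →L[ℂ] H))).map (amp μ))
      (WithLp.toLp 2 fun l => Γ.W ξ (z l)))
  rw [hnorm] at hle hin
  rw [hcoe]
  have heq : ⟪(WithLp.toLp 2 fun l => Γ.W η (w l) : PiLp 2 fun _ : Fin m => Lp H 2 μ),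
      matrixOp ((T.map (fun t => (t : H →L[ℂ] H))).map (amp μ))
      (WithLp.toLp 2 fun l => Γ.W ξ (z l))⟫_ℂ =
      ∑ k, ∑ l, ⟪Γ.W η (w k), ampL μ _ (T k l) (Γ.W ξ (z l))⟫_ℂ := by
    rw [PiLp.inner_apply]
    refine Finset.sum_congr rfl fun k _ => ?_
    rw [matrixOp_apply, inner_sum]
    rfl
  rw [← heq]
  calc _ ≤ _ := hin
    _ ≤ ‖η‖ * ‖w‖ * (N * (‖ξ‖ * ‖z‖)) := by
      gcongr
      refine hle.trans ?_
      gcongr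
      exact norm_matrixOp_amp_le _
    _ = _ := by ring

theorem norm_slice_le (T : Elem (generated s)) (ζ θ : H) :
    ‖Γ.slice T ζ θ‖ ≤ ‖T‖ * ‖ζ‖ * ‖θ‖ := by
  refine Elem.norm_le_of_norm_inner_le (by positivity) fun ξ η => ?_
  rw [inner_slice]
  calc _ ≤ ‖Γ.W η θ‖ * ‖ampL μ _ T (Γ.W ξ ζ)‖ := norm_inner_le_norm _ _
    _ ≤ ‖Γ.W η θ‖ * (‖T‖ * ‖Γ.W ξ ζ‖) := by
      gcongr
      exact (ContinuousLinearMap.le_opNorm _ _).trans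
        (mul_le_mul_of_nonneg_right (norm_amp_le _) (norm_nonneg _))
    _ = _ := by rw [norm_W, norm_W]; ring

/-- The sesquilinear form `(θ, ζ) ↦ φ ((id ⊗ ω) (Γ T))`. -/
def form (φ : StrongDual ℂ (Elem (generated s))) (T : Elem (generated s)) :
    H →L⋆[ℂ] H →L[ℂ] ℂ :=
  LinearMap.mkContinuous₂
    (LinearMap.mk₂'ₛₗ (starRingEnd ℂ) (RingHom.id ℂ) (fun θ ζ => φ (Γ.slice T ζ θ))
      (fun θ θ' ζ => by rw [slice_add_right, map_add])
      (fun c θ ζ => by rw [slice_smul_right, map_smul])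
      (fun θ ζ ζ' => by rw [slice_add_left, map_add])
      (fun c θ ζ => by rw [slice_smul_left, map_smul]; rfl))
    (‖φ‖ * ‖T‖)
    (fun θ ζ => by
      calc ‖φ (Γ.slice T ζ θ)‖ ≤ ‖φ‖ * ‖Γ.slice T ζ θ‖ := φ.le_opNorm _
        _ ≤ ‖φ‖ * (‖T‖ * ‖ζ‖ * ‖θ‖) := by
          gcongr
          exact Γ.norm_slice_le T ζ θ
        _ = _ := by ring)

/-- The operator `(φ ⊗ id) (Γ T)`, for `φ` in the dual of the von Neumann algebra. -/
def actOp (φ : StrongDual ℂ (Elem (generated s))) (T : Elem (generated s)) : H →L[ℂ] H :=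
  -- The representing operator stands in the conjugate-linear slot, with `θ`; the adjoint moves it
  -- onto `ζ`.
  (InnerProductSpace.continuousLinearMapOfBilin (Γ.form φ T)).adjoint

theorem inner_actOp (φ : StrongDual ℂ (Elem (generated s))) (T : Elem (generated s)) (ζ θ : H) :
    ⟪θ, Γ.actOp φ T ζ⟫_ℂ = φ (Γ.slice T ζ θ) := by
  rw [actOp, ContinuousLinearMap.adjoint_inner_right,
    InnerProductSpace.continuousLinearMapOfBilin_apply]
  rfl

theorem actOp_mem (φ : StrongDual ℂ (Elem (generated s))) (T : Elem (generated s)) :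
    Γ.actOp φ T ∈ (generated s).toStarSubalgebra := by
  refine mem_generated_iff.2 fun S hS => ?_
  ext1 ζ
  refine ext_inner_left ℂ fun θ => ?_
  rw [mul_apply_eq_comp, mul_apply_eq_comp, ← ContinuousLinearMap.adjoint_inner_left,
    inner_actOp, inner_actOp]
  congr 1
  exact Subtype.ext (Γ.sliceOp_commute T.2 hS ζ θ).symm

/-- `Comultiplication.actOp` as an operation on the von Neumann algebra generated by `s`. -/
def act (φ : StrongDual ℂ (Elem (generated s))) (T : Elem (generated s)) : Elem (generated s) :=
  ⟨Γ.actOp φ T, Γ.actOp_mem φ T⟩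

theorem inner_act (φ : StrongDual ℂ (Elem (generated s))) (T : Elem (generated s)) (ζ θ : H) :
    ⟪θ, (Γ.act φ T : H →L[ℂ] H) ζ⟫_ℂ = φ (Γ.slice T ζ θ) := Γ.inner_actOp φ T ζ θ

/-- Elements of `s` are group-like, hence eigenvectors of the action with eigenvalue `φ R`. Dually,
this makes `mulOp` pointwise multiplication on `s`. -/
theorem act_of_mem (φ : StrongDual ℂ (Elem (generated s))) (R : Elem (generated s))
    (hR : (R : H →L[ℂ] H) ∈ s) : Γ.act φ R = φ R • R := by
  refine Elem.ext_inner fun ζ θ => ?_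
  have : Γ.slice R ζ θ = ⟪θ, (R : H →L[ℂ] H) ζ⟫_ℂ • R := Subtype.ext (Γ.sliceOp_of_mem hR ζ θ)
  rw [inner_act, this, map_smul]
  show _ = ⟪θ, φ R • (R : H →L[ℂ] H) ζ⟫_ℂ
  rw [inner_smul_right, smul_eq_mul, mul_comm]

/-- The coefficient at `z`, `w` is `φ` of a single sum of slices, so the constant is `‖φ‖` at every
matrix size. -/
theorem norm_matrixOp_act_le (φ : StrongDual ℂ (Elem (generated s))) {m : ℕ}
    (T : Matrix (Fin m) (Fin m) (Elem (generated s))) :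
    ‖matrixOp (T.map fun t => (Γ.act φ t : H →L[ℂ] H))‖ ≤
      ‖φ‖ * ‖matrixOp (T.map (fun t => (t : H →L[ℂ] H)))‖ := by
  refine opNorm_le_of_norm_inner_le (by positivity) fun z w => ?_
  have heq : ⟪w, matrixOp (T.map fun t => (Γ.act φ t : H →L[ℂ] H)) z⟫_ℂ =
      φ (∑ k, ∑ l, Γ.slice (T k l) (z l) (w k)) := by
    rw [PiLp.inner_apply]
    simp only [matrixOp_apply, inner_sum, map_sum, Matrix.map_apply, inner_act]
  rw [heq]
  calc _ ≤ _ := φ.le_opNorm _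
    _ ≤ ‖φ‖ * (‖matrixOp (T.map (fun t => (t : H →L[ℂ] H)))‖ * ‖z‖ * ‖w‖) := by
      gcongr
      exact Γ.norm_sum_slice_le T z w
    _ = _ := by ring

theorem norm_act_le (φ : StrongDual ℂ (Elem (generated s))) (T : Elem (generated s)) :
    ‖Γ.act φ T‖ ≤ ‖φ‖ * ‖T‖ := by
  refine Elem.norm_le_of_norm_inner_le (by positivity) fun ζ θ => ?_
  rw [inner_act]
  calc ‖φ (Γ.slice T ζ θ)‖ ≤ ‖φ‖ * ‖Γ.slice T ζ θ‖ := φ.le_opNorm _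
    _ ≤ ‖φ‖ * (‖T‖ * ‖ζ‖ * ‖θ‖) := by
      gcongr
      exact Γ.norm_slice_le T ζ θ
    _ = _ := by ring

/-- `Comultiplication.act` as a continuous linear map. -/
def actL (φ : StrongDual ℂ (Elem (generated s))) :
    Elem (generated s) →L[ℂ] Elem (generated s) :=
  LinearMap.mkContinuous
    { toFun := Γ.act φ
      map_add' := fun S T => by
        refine Elem.ext_inner fun ζ θ => ?_
        show _ = ⟪θ, (Γ.act φ S : H →L[ℂ] H) ζ + (Γ.act φ T : H →L[ℂ] H) ζ⟫_ℂ
        rw [inner_add_right, inner_act, inner_act, inner_act, slice_add, map_add]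
      map_smul' := fun c T => by
        refine Elem.ext_inner fun ζ θ => ?_
        show _ = ⟪θ, c • (Γ.act φ T : H →L[ℂ] H) ζ⟫_ℂ
        rw [inner_smul_right, inner_act, inner_act, slice_smul, map_smul, smul_eq_mul] }
    ‖φ‖ (Γ.norm_act_le φ)

/-- `Comultiplication.slice` as a continuous linear map. -/
def sliceL (ζ θ : H) : Elem (generated s) →L[ℂ] Elem (generated s) :=
  LinearMap.mkContinuous
    { toFun := fun T => Γ.slice T ζ θ
      map_add' := fun S T => Γ.slice_add S T ζ θ
      map_smul' := fun c T => Γ.slice_smul c T ζ θ }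
    (‖ζ‖ * ‖θ‖) (fun T => (Γ.norm_slice_le T ζ θ).trans_eq (by ring))

/-- Normality is checked one functional at a time: with `ψ` a vector functional the composite is `φ`
of a slice, and with `φ` one as well it is a coefficient of the amplification. -/
theorem comp_actL_mem {φ ψ : StrongDual ℂ (Elem (generated s))} (hφ : φ ∈ predual (generated s))
    (hψ : ψ ∈ predual (generated s)) : ψ ∘L Γ.actL φ ∈ predual (generated s) := by
  refine mem_of_vectorFunctional_mem _
    ((ContinuousLinearMap.compL ℂ _ _ _).flip (Γ.actL φ)) (isClosed_predual _)
    (fun ζ θ => ?_) hψ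
  have h1 : (ContinuousLinearMap.compL ℂ _ _ _).flip (Γ.actL φ)
      (vectorFunctional (generated s) ζ θ) = φ ∘L Γ.sliceL ζ θ := by
    ext T
    exact Γ.inner_act φ T ζ θ
  rw [h1]
  refine mem_of_vectorFunctional_mem _
    ((ContinuousLinearMap.compL ℂ _ _ _).flip (Γ.sliceL ζ θ)) (isClosed_predual _)
    (fun ξ η => ?_) hφ
  have h2 : (ContinuousLinearMap.compL ℂ _ _ _).flip (Γ.sliceL ζ θ)
      (vectorFunctional (generated s) ξ η) = ampFunctional _ (Γ.W ξ ζ) (Γ.W η θ) := by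
    ext T
    exact Γ.inner_slice T ζ θ ξ η
  rw [h2]
  exact ampFunctional_mem _ _ _

/-- The multiplication operator `ψ ↦ (φ ⊗ ψ) ∘ Γ` on the predual. -/
def mulOp (φ : predual (generated s)) : predual (generated s) →ₗ[ℂ] predual (generated s) where
  toFun ψ := ⟨(ψ : StrongDual ℂ (Elem (generated s))) ∘L
    Γ.actL (φ : StrongDual ℂ (Elem (generated s))), Γ.comp_actL_mem φ.2 ψ.2⟩
  map_add' _ _ := rfl
  map_smul' _ _ := rfl

theorem mulOp_apply (φ ψ : predual (generated s)) (T : Elem (generated s)) :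
    (Γ.mulOp φ ψ : StrongDual ℂ (Elem (generated s))) T =
      (ψ : StrongDual ℂ (Elem (generated s)))
        (Γ.act (φ : StrongDual ℂ (Elem (generated s))) T) := rfl

theorem mulOp_apply_of_mem (φ ψ : predual (generated s)) (R : Elem (generated s))
    (hR : (R : H →L[ℂ] H) ∈ s) :
    (Γ.mulOp φ ψ : StrongDual ℂ (Elem (generated s))) R =
      (φ : StrongDual ℂ (Elem (generated s))) R * (ψ : StrongDual ℂ (Elem (generated s))) R := by
  rw [mulOp_apply, act_of_mem _ _ _ hR, map_smul, smul_eq_mul]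

theorem matNorm_mulOp_le (φ : predual (generated s)) {C : ℝ≥0} (hC : 0 < C) (hφC : ‖φ‖ ≤ C)
    {n : ℕ} (ψ : Matrix (Fin n) (Fin n) (predual (generated s))) :
    matNorm (generated s) (ψ.map (Γ.mulOp φ)) ≤ C * matNorm (generated s) ψ := by
  refine iSup_le fun m => iSup_le fun T => iSup_le fun hT => ?_
  -- The matrix norm is a supremum over the unit ball; dividing by `C` brings the image of `T` back
  -- into it, which is why `C` is taken positive rather than equal to `‖φ‖`.
  let T' : Matrix (Fin m) (Fin m) (Elem (generated s)) :=
    T.map fun t => ((C : ℂ)⁻¹) • Γ.act (φ : StrongDual ℂ (Elem (generated s))) t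
  have hC' : (C : ℂ) ≠ 0 := by exact_mod_cast hC.ne'
  have hT' : ‖matrixOp (T'.map (fun t => (t : H →L[ℂ] H)))‖ ≤ 1 := by
    have : T'.map (fun t => (t : H →L[ℂ] H)) = ((C : ℂ)⁻¹) •
        T.map fun t => (Γ.act (φ : StrongDual ℂ (Elem (generated s))) t : H →L[ℂ] H) := rfl
    rw [this, matrixOp_smul, norm_smul]
    have h1 := Γ.norm_matrixOp_act_le (φ : StrongDual ℂ (Elem (generated s))) T
    have h2 : ‖(C : ℂ)⁻¹‖ = (C : ℝ)⁻¹ := by simp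
    rw [h2]
    have h3 : (0 : ℝ) < C := hC
    rw [inv_mul_le_iff₀ h3, mul_one]
    refine h1.trans ?_
    calc _ ≤ (C : ℝ) * 1 := mul_le_mul hφC hT (norm_nonneg _) h3.le
      _ = C := mul_one _
  have hmat : (Matrix.of fun p q : Fin n × Fin m =>
      ((ψ.map (Γ.mulOp φ)) p.1 q.1 : StrongDual ℂ (Elem (generated s))) (T p.2 q.2)) =
      (C : ℂ) • Matrix.of fun p q : Fin n × Fin m =>
        (ψ p.1 q.1 : StrongDual ℂ (Elem (generated s))) (T' p.2 q.2) := by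
    ext p q
    simp only [Matrix.of_apply, Matrix.map_apply, Matrix.smul_apply, mulOp_apply, T', map_smul,
      smul_eq_mul]
    rw [mul_inv_cancel_left₀ hC']
  rw [hmat, map_smul, enorm_smul]
  have hCe : ‖(C : ℂ)‖ₑ = C := by
    rw [enorm_eq_nnnorm]
    simp
  rw [hCe]
  gcongr
  exact le_iSup_of_le m (le_iSup_of_le T' (le_iSup_of_le hT' le_rfl))

theorem cbOpNorm_mulOp_le (φ : predual (generated s)) {C : ℝ≥0} (hC : 0 < C) (hφC : ‖φ‖ ≤ C) :
    cbOpNorm (generated s) (Γ.mulOp φ) ≤ C :=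
  iInf₂_le C fun _ ψ => Γ.matNorm_mulOp_le φ hC hφC ψ

end Comultiplication
end Comultiplication

/-! ### The isometry `W` for a locally compact group. -/

section GroupComultiplication

open scoped CompactlySupported

variable {G : Type u} [Group G] [TopologicalSpace G] [IsTopologicalGroup G]
  [LocallyCompactSpace G] [MeasurableSpace G] [BorelSpace G]

theorem leftReg_coeFn (x : G) (ξ : L2 G) :
    leftReg G x ξ =ᵐ[Measure.haar] fun y => ξ (x⁻¹ * y) :=
  Lp.coeFn_compMeasurePreserving ξ (measurePreserving_mul_left (Measure.haar : Measure G) x⁻¹)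

theorem leftReg_mul (x y : G) : leftReg G (x * y) = leftReg G x * leftReg G y := by
  ext1 ξ
  apply Lp.ext
  have h := (measurePreserving_mul_left (Measure.haar : Measure G) x⁻¹).quasiMeasurePreserving.ae
    (leftReg_coeFn y ξ)
  filter_upwards [leftReg_coeFn (x * y) ξ, leftReg_coeFn x (leftReg G y ξ), h] with t h1 h2 h3
  rw [mul_apply_eq_comp, h1, h2, h3, mul_inv_rev, mul_assoc]

theorem leftReg_one : leftReg G 1 = 1 := by
  ext1 ξ
  apply Lp.ext
  filter_upwards [leftReg_coeFn 1 ξ] with t h1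
  rw [h1, inv_one, one_mul]
  rfl

theorem norm_leftReg_apply (x : G) (ξ : L2 G) : ‖leftReg G x ξ‖ = ‖ξ‖ :=
  (Lp.compMeasurePreservingₗᵢ ℂ (fun y : G => x⁻¹ * y)
    (measurePreserving_mul_left (Measure.haar : Measure G) x⁻¹)).norm_map ξ

theorem inner_leftReg (x : G) (ξ η : L2 G) : ⟪leftReg G x ξ, leftReg G x η⟫_ℂ = ⟪ξ, η⟫_ℂ :=
  (Lp.compMeasurePreservingₗᵢ ℂ (fun y : G => x⁻¹ * y)
    (measurePreserving_mul_left (Measure.haar : Measure G) x⁻¹)).inner_map_map ξ η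

theorem star_leftReg (x : G) : star (leftReg G x) = leftReg G x⁻¹ := by
  ext1 ξ
  refine ext_inner_left ℂ fun η => ?_
  rw [ContinuousLinearMap.star_eq_adjoint, ContinuousLinearMap.adjoint_inner_right,
    ← inner_leftReg x η, ← mul_apply_eq_comp, ← leftReg_mul, mul_inv_cancel, leftReg_one]
  rfl

theorem memLp_cc (f : C_c(G, ℂ)) : MemLp f 2 (Measure.haar : Measure G) :=
  f.continuous.memLp_of_hasCompactSupport f.hasCompactSupport

/-- The inclusion of the compactly supported continuous functions in `L²(G)`. -/
def ccToL2 : C_c(G, ℂ) →ₗ[ℂ] L2 G where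
  toFun f := (memLp_cc f).toLp f
  map_add' _ _ := rfl
  map_smul' _ _ := rfl

theorem coeFn_ccToL2 (f : C_c(G, ℂ)) : ccToL2 f =ᵐ[Measure.haar] f :=
  MemLp.coeFn_toLp (memLp_cc f)

/-- Regularity of Haar measure and Urysohn's lemma: an indicator is squeezed between a compact set
and an open set, and a cut-off function between them approximates it. -/
theorem denseRange_ccToL2 [T2Space G] : DenseRange (ccToL2 : C_c(G, ℂ) →ₗ[ℂ] L2 G) := by
  intro ξ
  let V : Submodule ℂ (L2 G) := (LinearMap.range (ccToL2 : C_c(G, ℂ) →ₗ[ℂ] L2 G)).topologicalClosure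
  show ξ ∈ V
  refine Lp.induction (by simp) (fun ξ => ξ ∈ V) ?_ (fun f g hf hg _ h1 h2 => add_mem h1 h2)
    (Submodule.isClosed_topologicalClosure _) ξ
  intro c t ht hμt
  refine Metric.mem_closure_iff.2 fun ε hε => ?_
  -- The cut-off differs from the indicator only on `U \ s ∪ t \ s`, by at most `‖c‖`; each of the
  -- two pieces is given measure at most `η / 2`.
  obtain ⟨η, hη, hηle⟩ := exists_eLpNorm_indicator_le (p := 2) (μ := (Measure.haar : Measure G))
    ENNReal.ofNat_ne_top c (ε := ENNReal.ofReal (ε / 2)) (by simpa using hε)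
  have hη2 : ((η / 2 : ℝ≥0) : ℝ≥0∞) ≠ 0 := by simpa using hη.ne'
  obtain ⟨s, hst, hs, hsc, hμs⟩ := ht.exists_isCompact_isClosed_sdiff_lt hμt.ne hη2
  obtain ⟨U, hsU, hU, -, hμU⟩ := hs.measurableSet.exists_isOpen_sdiff_lt
    (μ := Measure.haar) hs.measure_ne_top hη2
  obtain ⟨f, hf1, hf0, hfc, hf⟩ := exists_continuous_one_zero_of_isCompact hs hU.isClosed_compl
    (Set.disjoint_compl_right_iff_subset.2 hsU)
  let g : C_c(G, ℂ) := ⟨⟨fun x => (f x : ℂ) * c, by fun_prop⟩, by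
    refine hfc.mono fun x hx => ?_
    simp only [Function.mem_support] at hx ⊢
    intro h
    simp [h] at hx⟩
  refine ⟨ccToL2 g, ⟨g, rfl⟩, ?_⟩
  rw [dist_eq_norm, Lp.norm_def]
  refine (ENNReal.toReal_le_of_le_ofReal (by positivity) ?_).trans_lt (half_lt_self hε)
  refine le_trans (eLpNorm_mono_ae ?_) (hηle (U \ s ∪ t \ s) ?_)
  · filter_upwards [Lp.coeFn_sub (indicatorConstLp 2 ht hμt.ne c) (ccToL2 g), coeFn_ccToL2 g,
      indicatorConstLp_coeFn (p := 2) (hs := ht) (hμs := hμt.ne) (c := c)] with x h1 h2 h3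
    have hx : (indicatorConstLp 2 ht hμt.ne c - ccToL2 g : L2 G) x =
        t.indicator (fun _ => c) x - f x * c := by
      rw [h1, Pi.sub_apply, h2, h3]
      rfl
    refine (congrArg norm hx).trans_le ?_
    by_cases hxs : x ∈ s
    · have h1 : f x = 1 := hf1 hxs
      simp [hxs, hst hxs, h1]
    · have h01 := hf x
      by_cases hxt : x ∈ t
      · rw [Set.indicator_of_mem hxt, Set.indicator_of_mem (show x ∈ U \ s ∪ t \ s from Or.inr ⟨hxt, hxs⟩)]
        have : c - f x * c = ((1 - f x : ℝ) : ℂ) * c := by push_cast; ring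
        rw [this, norm_mul, Complex.norm_real, Real.norm_eq_abs, abs_of_nonneg (by linarith [h01.2])]
        exact mul_le_of_le_one_left (norm_nonneg _) (by linarith [h01.1])
      · rw [Set.indicator_of_notMem hxt, zero_sub, norm_neg]
        by_cases hxU : x ∈ U
        · rw [Set.indicator_of_mem (show x ∈ U \ s ∪ t \ s from Or.inl ⟨hxU, hxs⟩), norm_mul, Complex.norm_real,
            Real.norm_eq_abs, abs_of_nonneg h01.1]
          exact mul_le_of_le_one_left (norm_nonneg _) h01.2
        · have h0 : f x = 0 := hf0 hxU
          simp [h0]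
  · calc _ ≤ _ := measure_union_le _ _
      _ ≤ ((η / 2 : ℝ≥0) : ℝ≥0∞) + ((η / 2 : ℝ≥0) : ℝ≥0∞) := add_le_add hμU.le hμs.le
      _ = η := by rw [← ENNReal.coe_add, add_halves]

theorem inner_ccToL2 (f g : C_c(G, ℂ)) :
    ⟪ccToL2 f, ccToL2 g⟫_ℂ = ∫ t, g t * starRingEnd ℂ (f t) ∂(Measure.haar : Measure G) := by
  rw [L2.inner_def]
  apply integral_congr_ae
  filter_upwards [coeFn_ccToL2 f, coeFn_ccToL2 g] with t h1 h2
  rw [h1, h2]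
  rfl

/-- The function `s ↦ f (x⁻¹ s)`. -/
def translate (x : G) (f : C_c(G, ℂ)) : C_c(G, ℂ) where
  toFun s := f (x⁻¹ * s)
  continuous_toFun := by fun_prop
  hasCompactSupport' := f.hasCompactSupport.comp_homeomorph (Homeomorph.mulLeft x⁻¹)

theorem leftReg_ccToL2 (x : G) (f : C_c(G, ℂ)) :
    leftReg G x (ccToL2 f) = ccToL2 (translate x f) := by
  apply Lp.ext
  have h := (measurePreserving_mul_left (Measure.haar : Measure G) x⁻¹).quasiMeasurePreserving.ae
    (coeFn_ccToL2 f)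
  filter_upwards [leftReg_coeFn x (ccToL2 f), coeFn_ccToL2 (translate x f), h] with t h1 h2 h3
  rw [h1, h2, h3]
  rfl

/-- The function `s ↦ f s * g (s t)`. -/
def mulTranslate (f g : C_c(G, ℂ)) (t : G) : C_c(G, ℂ) where
  toFun s := f s * g (s * t)
  continuous_toFun := by fun_prop
  hasCompactSupport' := f.hasCompactSupport.mul_right

/-- The functions `g(· t)` depend continuously on `t` in the compact-open topology, hence uniformly
on the compact support of `f`; multiplication by `f` turns this into `L²` continuity. -/
theorem continuous_mulTranslate (f g : C_c(G, ℂ)) :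
    Continuous fun t => ccToL2 (mulTranslate f g t) := by
  refine continuous_iff_continuousAt.2 fun t₀ => ?_
  refine Metric.tendsto_nhds.2 fun ε hε => ?_
  let F : C(G, C(G, ℂ)) := ContinuousMap.curry ⟨fun p : G × G => g (p.2 * p.1), by fun_prop⟩
  have hF : Tendsto F (𝓝 t₀) (𝓝 (F t₀)) := F.continuous.tendsto t₀
  have hunif := ContinuousMap.tendsto_iff_forall_isCompact_tendstoUniformlyOn.1 hF _
    f.hasCompactSupport
  obtain ⟨δ, hδ, hδε⟩ : ∃ δ > 0, δ * ‖ccToL2 f‖ < ε :=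
    ⟨ε / (‖ccToL2 f‖ + 1), by positivity, by
      rw [div_mul_eq_mul_div, div_lt_iff₀ (by positivity)]
      nlinarith [norm_nonneg (ccToL2 f)]⟩
  filter_upwards [Metric.tendstoUniformlyOn_iff.1 hunif δ hδ] with t ht
  rw [dist_eq_norm, ← map_sub]
  refine lt_of_le_of_lt (Lp.norm_le_mul_norm_of_ae_le_mul ?_) hδε
  filter_upwards [coeFn_ccToL2 f, coeFn_ccToL2 (mulTranslate f g t - mulTranslate f g t₀)]
    with s h1 h2
  rw [h1, h2]
  show ‖f s * g (s * t) - f s * g (s * t₀)‖ ≤ _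
  rw [← mul_sub, norm_mul, mul_comm]
  by_cases hs : s ∈ tsupport f
  · gcongr
    have := ht s hs
    rw [dist_comm, dist_eq_norm] at this
    exact this.le
  · simp [image_eq_zero_of_notMem_tsupport hs]

omit [LocallyCompactSpace G] [MeasurableSpace G] [BorelSpace G] in
theorem exists_isCompact_mulTranslate_eq_zero [T2Space G] (f g : C_c(G, ℂ)) :
    ∃ K : Set (G × G), IsCompact K ∧ ∀ t s, (t, s) ∉ K → mulTranslate f g t s = 0 := by
  -- A nonzero value requires `s ∈ supp f` and `u = st ∈ supp g`, so that `t = s⁻¹u`.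
  refine ⟨_, (f.hasCompactSupport.isCompact.prod g.hasCompactSupport.isCompact).image
    (f := fun p : G × G => (p.1⁻¹ * p.2, p.1)) (by fun_prop), fun t s h => ?_⟩
  by_contra h0
  have h1 : f s * g (s * t) ≠ 0 := h0
  refine h ⟨(s, s * t), ⟨subset_tsupport _ (left_ne_zero_of_mul h1),
    subset_tsupport _ (right_ne_zero_of_mul h1)⟩, by simp⟩

theorem hasCompactSupport_mulTranslate [T2Space G] (f g : C_c(G, ℂ)) :
    HasCompactSupport fun t => ccToL2 (mulTranslate f g t) := by
  obtain ⟨K, hK, h0⟩ := exists_isCompact_mulTranslate_eq_zero f g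
  refine HasCompactSupport.intro (hK.image continuous_fst) fun t ht => ?_
  have : mulTranslate f g t = 0 := by
    ext s
    exact h0 t s fun h => ht ⟨_, h, rfl⟩
  rw [this, map_zero]

theorem memLp_mulTranslate [T2Space G] (f g : C_c(G, ℂ)) :
    MemLp (fun t => ccToL2 (mulTranslate f g t)) 2 (Measure.haar : Measure G) :=
  (continuous_mulTranslate f g).memLp_of_hasCompactSupport (hasCompactSupport_mulTranslate f g)

/-- The map `f ⊗ g ↦ (t ↦ f · g(· t))` on compactly supported continuous functions. -/
def ccW [T2Space G] :
    C_c(G, ℂ) →ₗ[ℂ] C_c(G, ℂ) →ₗ[ℂ] Lp (L2 G) 2 (Measure.haar : Measure G) :=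
  LinearMap.mk₂ ℂ (fun g f => (memLp_mulTranslate f g).toLp _)
    (fun g g' f => by
      rw [← MemLp.toLp_add]
      congr 1
      ext1 t
      rw [Pi.add_apply, ← map_add]
      congr 1
      ext s
      exact mul_add _ _ _)
    (fun c g f => by
      rw [← MemLp.toLp_const_smul]
      congr 1
      ext1 t
      rw [Pi.smul_apply, ← map_smul]
      congr 1
      ext s
      exact mul_left_comm _ _ _)
    (fun g f f' => by
      rw [← MemLp.toLp_add]
      congr 1
      ext1 t
      rw [Pi.add_apply, ← map_add]
      congr 1
      ext s
      exact add_mul _ _ _)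
    (fun c g f => by
      rw [← MemLp.toLp_const_smul]
      congr 1
      ext1 t
      rw [Pi.smul_apply, ← map_smul]
      congr 1
      ext s
      exact mul_assoc _ _ _)

theorem coeFn_ccW [T2Space G] (g f : C_c(G, ℂ)) :
    ccW g f =ᵐ[Measure.haar] fun t => ccToL2 (mulTranslate f g t) :=
  MemLp.coeFn_toLp (memLp_mulTranslate f g)

/-- After exchanging the integrals, left invariance removes `s` from `g(st)` and the double integral
factors. Haar measure need not be σ-finite, so Fubini is used for continuous compactly supported
integrands; hence the construction on `C_c` before extension to `L²`. -/
theorem inner_ccW [T2Space G] (g f g' f' : C_c(G, ℂ)) :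
    ⟪ccW g f, ccW g' f'⟫_ℂ = ⟪ccToL2 f, ccToL2 f'⟫_ℂ * ⟪ccToL2 g, ccToL2 g'⟫_ℂ := by
  have h1 : ⟪ccW g f, ccW g' f'⟫_ℂ = ∫ t, ∫ s, mulTranslate f' g' t s *
      starRingEnd ℂ (mulTranslate f g t s) ∂(Measure.haar : Measure G)
      ∂(Measure.haar : Measure G) := by
    rw [L2.inner_def]
    apply integral_congr_ae
    filter_upwards [coeFn_ccW g f, coeFn_ccW g' f'] with t h1 h2
    rw [h1, h2, inner_ccToL2]
  rw [h1, integral_integral_swap_of_hasCompactSupport, inner_ccToL2, inner_ccToL2,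
    ← integral_mul_const]
  · congr 1
    ext1 s
    have h2 : ∫ t, g' (s * t) * starRingEnd ℂ (g (s * t)) ∂(Measure.haar : Measure G) =
        ∫ t, g' t * starRingEnd ℂ (g t) ∂(Measure.haar : Measure G) :=
      integral_mul_left_eq_self (fun t => g' t * starRingEnd ℂ (g t)) s
    rw [← h2, ← integral_const_mul]
    congr 1
    ext1 t
    show f' s * g' (s * t) * starRingEnd ℂ (f s * g (s * t)) = _
    rw [map_mul (starRingEnd ℂ)]
    ring
  · show Continuous fun p : G × G =>
      f' p.2 * g' (p.2 * p.1) * starRingEnd ℂ (f p.2 * g (p.2 * p.1))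
    fun_prop
  · obtain ⟨K, hK, h0⟩ := exists_isCompact_mulTranslate_eq_zero f' g'
    refine HasCompactSupport.intro hK fun p hp => ?_
    show mulTranslate f' g' p.1 p.2 * starRingEnd ℂ (mulTranslate f g p.1 p.2) = 0
    rw [h0 _ _ hp, zero_mul]

theorem norm_ccW [T2Space G] (g f : C_c(G, ℂ)) :
    ‖ccW g f‖ = ‖ccToL2 g‖ * ‖ccToL2 f‖ := by
  have h := inner_ccW g f g f
  simp only [inner_self_eq_norm_sq_to_K] at h
  have h2 : ‖ccW g f‖ ^ 2 = (‖ccToL2 g‖ * ‖ccToL2 f‖) ^ 2 := by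
    rw [mul_pow, mul_comm]
    exact_mod_cast h
  exact (sq_eq_sq₀ (norm_nonneg _) (by positivity)).1 h2

/-- Left and right translations commute, so translating the product in `s` translates both factors.
-/
theorem amp_ccW [T2Space G] (x : G) (g f : C_c(G, ℂ)) :
    amp Measure.haar (leftReg G x) (ccW g f) = ccW (translate x g) (translate x f) := by
  apply Lp.ext
  filter_upwards [coeFn_amp (leftReg G x) (ccW g f), coeFn_ccW g f,
    coeFn_ccW (translate x g) (translate x f)] with t h1 h2 h3
  rw [h1, h2, h3, leftReg_ccToL2]
  congr 1
  ext s
  show f (x⁻¹ * s) * g (x⁻¹ * s * t) = f (x⁻¹ * s) * g (x⁻¹ * (s * t))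
  rw [mul_assoc]

/-- The extension of `ccW` to `L²(G)` in the second variable. -/
def partialW [T2Space G] :
    C_c(G, ℂ) →ₗ[ℂ] L2 G →L[ℂ] Lp (L2 G) 2 (Measure.haar : Measure G) where
  toFun g := (ccW g).extendOfNorm ccToL2
  map_add' g g' := by
    refine LinearMap.extendOfNorm_unique denseRange_ccToL2 (‖ccToL2 (g + g')‖)
      (fun f => (norm_ccW _ _).le) _ ?_
    ext1 f
    simp [LinearMap.extendOfNorm_eq denseRange_ccToL2 ⟨_, fun f => (norm_ccW _ f).le⟩]
  map_smul' c g := by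
    refine LinearMap.extendOfNorm_unique denseRange_ccToL2 (‖ccToL2 (c • g)‖)
      (fun f => (norm_ccW _ _).le) _ ?_
    ext1 f
    simp [LinearMap.extendOfNorm_eq denseRange_ccToL2 ⟨_, fun f => (norm_ccW _ f).le⟩]

theorem partialW_ccToL2 [T2Space G] (g f : C_c(G, ℂ)) : partialW g (ccToL2 f) = ccW g f :=
  LinearMap.extendOfNorm_eq denseRange_ccToL2 ⟨_, fun f => (norm_ccW g f).le⟩ f

theorem norm_partialW_le [T2Space G] (g : C_c(G, ℂ)) : ‖partialW g‖ ≤ 1 * ‖ccToL2 g‖ := by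
  rw [one_mul]
  exact LinearMap.opNorm_extendOfNorm_le denseRange_ccToL2 (norm_nonneg _)
    fun f => (norm_ccW g f).le

variable (G) in
/-- The extension of `ccW` to `L²(G)` in both variables. -/
def extW [T2Space G] : L2 G →L[ℂ] L2 G →L[ℂ] Lp (L2 G) 2 (Measure.haar : Measure G) :=
  partialW.extendOfNorm ccToL2

theorem extW_ccToL2 [T2Space G] (g f : C_c(G, ℂ)) : extW G (ccToL2 g) (ccToL2 f) = ccW g f := by
  have h : extW G (ccToL2 g) = partialW g :=
    LinearMap.extendOfNorm_eq denseRange_ccToL2 ⟨1, norm_partialW_le⟩ g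
  rw [h, partialW_ccToL2]

theorem inner_extW [T2Space G] (ζ ξ θ η : L2 G) :
    ⟪extW G ζ ξ, extW G θ η⟫_ℂ = ⟪ξ, η⟫_ℂ * ⟪ζ, θ⟫_ℂ := by
  refine denseRange_ccToL2.induction_on ζ (isClosed_eq (by fun_prop) (by fun_prop)) fun g => ?_
  refine denseRange_ccToL2.induction_on ξ (isClosed_eq (by fun_prop) (by fun_prop)) fun f => ?_
  refine denseRange_ccToL2.induction_on θ (isClosed_eq (by fun_prop) (by fun_prop)) fun g' => ?_
  refine denseRange_ccToL2.induction_on η (isClosed_eq (by fun_prop) (by fun_prop)) fun f' => ?_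
  rw [extW_ccToL2, extW_ccToL2, inner_ccW]

theorem amp_extW [T2Space G] (x : G) (ζ ξ : L2 G) :
    amp Measure.haar (leftReg G x) (extW G ζ ξ) = extW G (leftReg G x ζ) (leftReg G x ξ) := by
  refine denseRange_ccToL2.induction_on ζ (isClosed_eq (by fun_prop) (by fun_prop)) fun g => ?_
  refine denseRange_ccToL2.induction_on ξ (isClosed_eq (by fun_prop) (by fun_prop)) fun f => ?_
  rw [extW_ccToL2, amp_ccW, leftReg_ccToL2, leftReg_ccToL2, extW_ccToL2]

variable (G) in
/-- The comultiplication of `VN(G)`. -/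
def comultiplicationVN [T2Space G] :
    Comultiplication (Set.range (leftReg G)) (Measure.haar : Measure G) where
  -- The factor `g`, evaluated at `st`, is the first variable of `extW` but the second leg of the
  -- tensor.
  W := (extW G).flip
  inner_W ξ ζ η θ := inner_extW ζ ξ θ η
  amp_W := by
    rintro _ ⟨x, rfl⟩ ξ ζ
    exact amp_extW x ζ ξ
  one_mem := ⟨1, leftReg_one⟩
  star_mem := by
    rintro _ ⟨x, rfl⟩
    exact ⟨x⁻¹, (star_leftReg x).symm⟩
  mul_mem := by
    rintro _ ⟨x, rfl⟩ _ ⟨y, rfl⟩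
    exact ⟨x * y, leftReg_mul x y⟩

/-- The elements of `A(G)` are completely bounded multipliers of `A(G)`. -/
theorem cbNorm_toFun_le [T2Space G] (φ : FourierAlgebra G) {C : ℝ≥0} (hC : 0 < C) (hφ : ‖φ‖ ≤ C) :
    cbNorm (FourierAlgebra.toFun φ) ≤ C := by
  refine (iInf₂_le ((comultiplicationVN G).mulOp φ) fun ψ x => ?_).trans
    ((comultiplicationVN G).cbOpNorm_mulOp_le φ hC hφ)
  exact (comultiplicationVN G).mulOp_apply_of_mem φ ψ (leftRegVN G x) ⟨x, rfl⟩

end GroupComultiplication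

/-! ### Elementary estimates for the matrix norms of the predual. -/

section MatrixNorms

variable {H : Type u} [NormedAddCommGroup H] [InnerProductSpace ℂ H] [CompleteSpace H]

theorem norm_entry_le_norm_toEuclideanCLM {n : Type*} [Fintype n] [DecidableEq n]
    (A : Matrix n n ℂ) (i j : n) : ‖A i j‖ ≤ ‖Matrix.toEuclideanCLM (n := n) (𝕜 := ℂ) A‖ := by
  have h1 := (Matrix.toEuclideanCLM (n := n) (𝕜 := ℂ) A).le_opNorm (EuclideanSpace.single j 1)
  have h2 := PiLp.norm_apply_le
    (Matrix.toEuclideanCLM (n := n) (𝕜 := ℂ) A (EuclideanSpace.single j 1)) i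
  simp only [Matrix.ofLp_toEuclideanCLM, PiLp.ofLp_single, Matrix.mulVec_single_one,
    Matrix.col_apply] at h2
  simpa using h2.trans h1

/-- The negative of a linear map. -/
def negOneSMul {A : Type*} [AddCommMonoid A] [Module ℂ A] (S : A →ₗ[ℂ] A) : A →ₗ[ℂ] A :=
  (-1 : ℂ) • S

variable (M : VonNeumannAlgebra H)

theorem matNorm_add_le {n : ℕ} (φ ψ : Matrix (Fin n) (Fin n) (predual M)) :
    matNorm M (φ + ψ) ≤ matNorm M φ + matNorm M ψ := by
  refine iSup_le fun m => iSup_le fun T => iSup_le fun hT => ?_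
  have : (Matrix.of fun p q : Fin n × Fin m =>
      ((φ + ψ) p.1 q.1 : StrongDual ℂ (Elem M)) (T p.2 q.2)) =
      (Matrix.of fun p q : Fin n × Fin m => (φ p.1 q.1 : StrongDual ℂ (Elem M)) (T p.2 q.2)) +
      Matrix.of fun p q : Fin n × Fin m => (ψ p.1 q.1 : StrongDual ℂ (Elem M)) (T p.2 q.2) := rfl
  rw [this, map_add]
  refine (enorm_add_le (Matrix.toEuclideanCLM (n := Fin n × Fin m) (𝕜 := ℂ) _)
    (Matrix.toEuclideanCLM (n := Fin n × Fin m) (𝕜 := ℂ) _)).trans (add_le_add ?_ ?_)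
  · exact le_iSup_of_le m (le_iSup_of_le T (le_iSup_of_le hT le_rfl))
  · exact le_iSup_of_le m (le_iSup_of_le T (le_iSup_of_le hT le_rfl))

theorem matNorm_map_neg_one_smul {n : ℕ} (S : predual M →ₗ[ℂ] predual M)
    (φ : Matrix (Fin n) (Fin n) (predual M)) :
    matNorm M (φ.map (negOneSMul S)) = matNorm M (φ.map S) := by
  refine iSup_congr fun m => iSup_congr fun T => iSup_congr fun hT => ?_
  have : (Matrix.of fun p q : Fin n × Fin m =>
      ((φ.map (negOneSMul S)) p.1 q.1 : StrongDual ℂ (Elem M)) (T p.2 q.2)) =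
      (-1 : ℂ) • (Matrix.of fun p q : Fin n × Fin m =>
        ((φ.map S) p.1 q.1 : StrongDual ℂ (Elem M)) (T p.2 q.2)) := rfl
  rw [this, map_smul, enorm_smul, enorm_neg, enorm_one, one_mul]

theorem enorm_apply_le_matNorm (φ : Matrix (Fin 1) (Fin 1) (predual M)) (T : Elem M)
    (hT : ‖T‖ ≤ 1) : ‖(φ 0 0 : StrongDual ℂ (Elem M)) T‖ₑ ≤ matNorm M φ := by
  refine le_iSup_of_le 1 (le_iSup_of_le (Matrix.of fun _ _ => T) (le_iSup_of_le ?_ ?_))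
  · refine ContinuousLinearMap.opNorm_le_bound _ zero_le_one fun x => ?_
    refine le_of_sq_le_sq ?_ (by positivity)
    rw [one_mul, PiLp.norm_sq_eq_of_L2, PiLp.norm_sq_eq_of_L2]
    simp only [matrixOp_apply, Finset.univ_unique, Finset.sum_singleton, Matrix.map_apply,
      Matrix.of_apply]
    gcongr
    exact ((T : H →L[ℂ] H).le_opNorm _).trans (mul_le_of_le_one_left (norm_nonneg _) hT)
  · rw [← ofReal_norm, ← ofReal_norm]
    exact ENNReal.ofReal_le_ofReal (norm_entry_le_norm_toEuclideanCLM
      (Matrix.of fun p q : Fin 1 × Fin 1 => (φ p.1 q.1 : StrongDual ℂ (Elem M)) T) (0, 0) (0, 0))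

/-- The scalar matrix `[⟪η, T_kl ξ⟫]` is the compression of `[T_kl]` along `z ↦ z ⊗ ξ` and `w ↦ w ⊗
η`, maps that scale norms by `‖ξ‖` and `‖η‖`. -/
theorem matNorm_vectorFunctional_le (ξ η : H) :
    matNorm M (Matrix.of fun _ _ : Fin 1 =>
      (⟨vectorFunctional M ξ η, vectorFunctional_mem M ξ η⟩ : predual M)) ≤
      ENNReal.ofReal (‖ξ‖ * ‖η‖) := by
  refine iSup_le fun m => iSup_le fun T => iSup_le fun hT => ?_
  rw [← ofReal_norm]
  refine ENNReal.ofReal_le_ofReal (opNorm_le_of_norm_inner_le (by positivity) fun z w => ?_)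
  let v : EuclideanSpace ℂ (Fin 1 × Fin m) → H → PiLp 2 fun _ : Fin m => H :=
    fun z ξ => WithLp.toLp 2 fun l => z (0, l) • ξ
  have hv : ∀ z ξ, ‖v z ξ‖ = ‖z‖ * ‖ξ‖ := by
    intro z ξ
    refine (sq_eq_sq₀ (norm_nonneg _) (by positivity)).1 ?_
    rw [mul_pow, PiLp.norm_sq_eq_of_L2, EuclideanSpace.norm_sq_eq, Fintype.sum_prod_type,
      Finset.sum_mul]
    simp [v, norm_smul, mul_pow, Finset.sum_mul]
  have heq : ⟪w, Matrix.toEuclideanCLM (n := Fin 1 × Fin m) (𝕜 := ℂ)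
      (Matrix.of fun p q => (vectorFunctional M ξ η) (T p.2 q.2)) z⟫_ℂ =
      ⟪v w η, matrixOp (T.map (fun t => (t : H →L[ℂ] H))) (v z ξ)⟫_ℂ := by
    rw [PiLp.inner_apply, PiLp.inner_apply, Fintype.sum_prod_type]
    simp only [Finset.univ_unique, Finset.sum_singleton]
    refine Finset.sum_congr rfl fun k _ => ?_
    rw [matrixOp_apply, inner_sum, Matrix.ofLp_toEuclideanCLM, Matrix.mulVec, dotProduct,
      Fintype.sum_prod_type]
    simp only [Finset.univ_unique, Finset.sum_singleton, inner_sum]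
    refine Finset.sum_congr rfl fun l _ => ?_
    simp only [v, Matrix.of_apply, vectorFunctional_apply, Matrix.map_apply, map_smul,
      inner_smul_left, inner_smul_right, RCLike.inner_apply]
    show _ * z (0, l) * starRingEnd ℂ (w (0, k)) = z (0, l) * (starRingEnd ℂ (w (0, k)) * _)
    ring
  refine (congrArg norm heq).trans_le ((norm_inner_le_norm _ _).trans ?_)
  have h1 := (matrixOp (T.map (fun t => (t : H →L[ℂ] H)))).le_of_opNorm_le hT (v z ξ)
  rw [one_mul, hv] at h1
  rw [hv]
  calc _ ≤ ‖w‖ * ‖η‖ * (‖z‖ * ‖ξ‖) := by gcongr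
    _ = _ := by ring

end MatrixNorms

/-! ### The cb-multiplier norm as a seminorm dominating the supremum norm. -/

section Multipliers

variable {G : Type u} [Group G] [TopologicalSpace G] [IsTopologicalGroup G]
  [LocallyCompactSpace G] [MeasurableSpace G] [BorelSpace G] {f g : G → ℂ} {C D : ℝ≥0}

/-- `f` is a completely bounded multiplier of `A(G)` with a bound `C` for its norm. -/
def IsCbMultiplier (f : G → ℂ) (C : ℝ≥0) : Prop :=
  ∃ S : FourierAlgebra G →ₗ[ℂ] FourierAlgebra G, IsMultiplicationBy f S ∧
    ∀ (n : ℕ) (φ : Matrix (Fin n) (Fin n) (FourierAlgebra G)),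
      matNorm (VN G) (φ.map S) ≤ C * matNorm (VN G) φ

theorem IsCbMultiplier.cbNorm_le (h : IsCbMultiplier f C) : cbNorm f ≤ C := by
  obtain ⟨S, hS, hC⟩ := h
  exact (iInf₂_le S hS).trans (iInf₂_le C hC)

theorem exists_isCbMultiplier_of_cbNorm_lt {r : ℝ≥0∞} (h : cbNorm f < r) :
    ∃ C : ℝ≥0, (C : ℝ≥0∞) < r ∧ IsCbMultiplier f C := by
  simp only [cbNorm, cbOpNorm, iInf_lt_iff] at h
  obtain ⟨S, hS, C, hC, hr⟩ := h
  exact ⟨C, hr, S, hS, hC⟩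

set_option synthInstance.maxHeartbeats 200000 in
theorem IsCbMultiplier.add (hf : IsCbMultiplier f C) (hg : IsCbMultiplier g D) :
    IsCbMultiplier (f + g) (C + D) := by
  obtain ⟨S, hS, hC⟩ := hf
  obtain ⟨T, hT, hD⟩ := hg
  refine ⟨S + T, fun φ x => ?_, fun n φ => ?_⟩
  · have : FourierAlgebra.toFun ((S + T) φ) x =
        FourierAlgebra.toFun (S φ) x + FourierAlgebra.toFun (T φ) x := rfl
    rw [this, hS, hT, Pi.add_apply, add_mul]
  · have : φ.map (S + T) = φ.map S + φ.map T := rfl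
    rw [this, ENNReal.coe_add, add_mul]
    exact (matNorm_add_le _ _ _).trans (add_le_add (hC n φ) (hD n φ))

theorem IsCbMultiplier.neg (hf : IsCbMultiplier f C) : IsCbMultiplier (-f) C := by
  obtain ⟨S, hS, hC⟩ := hf
  refine ⟨negOneSMul S, fun φ x => ?_,
    fun n φ => (matNorm_map_neg_one_smul (VN G) S φ).trans_le (hC n φ)⟩
  have : FourierAlgebra.toFun ((negOneSMul S) φ) x = -1 * FourierAlgebra.toFun (S φ) x := rfl
  rw [this, hS, Pi.neg_apply]
  ring

theorem IsCbMultiplier.mul (hf : IsCbMultiplier f C) (hg : IsCbMultiplier g D) :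
    IsCbMultiplier (f * g) (C * D) := by
  obtain ⟨S, hS, hC⟩ := hf
  obtain ⟨T, hT, hD⟩ := hg
  refine ⟨S ∘ₗ T, fun φ x => ?_, fun n φ => ?_⟩
  · rw [LinearMap.comp_apply, hS, hT, Pi.mul_apply, mul_assoc]
  · have : φ.map (S ∘ₗ T) = (φ.map T).map S := rfl
    rw [this, ENNReal.coe_mul, mul_assoc]
    exact (hC n _).trans (by gcongr; exact hD n φ)

theorem cbNorm_add_le (f g : G → ℂ) : cbNorm (f + g) ≤ cbNorm f + cbNorm g := by
  refine ENNReal.le_of_forall_pos_le_add fun ε hε hlt => ?_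
  have hε2 : ((ε / 2 : ℝ≥0) : ℝ≥0∞) ≠ 0 := by simpa using hε.ne'
  obtain ⟨hf, hg⟩ := ENNReal.add_lt_top.1 hlt
  obtain ⟨C, hC, hfC⟩ := exists_isCbMultiplier_of_cbNorm_lt (ENNReal.lt_add_right hf.ne hε2)
  obtain ⟨D, hD, hgD⟩ := exists_isCbMultiplier_of_cbNorm_lt (ENNReal.lt_add_right hg.ne hε2)
  calc cbNorm (f + g) ≤ ((C + D : ℝ≥0) : ℝ≥0∞) := (hfC.add hgD).cbNorm_le
    _ ≤ (cbNorm f + (ε / 2 : ℝ≥0)) + (cbNorm g + (ε / 2 : ℝ≥0)) := by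
      rw [ENNReal.coe_add]
      exact add_le_add hC.le hD.le
    _ = cbNorm f + cbNorm g + ε := by
      rw [add_add_add_comm, ← ENNReal.coe_add, add_halves]

theorem cbNorm_neg_le (f : G → ℂ) : cbNorm (-f) ≤ cbNorm f := by
  refine le_of_forall_gt fun r hr => ?_
  obtain ⟨C, hC, hfC⟩ := exists_isCbMultiplier_of_cbNorm_lt hr
  exact hfC.neg.cbNorm_le.trans_lt hC

variable (G) in
theorem exists_L2_ne_zero [T2Space G] : ∃ ξ : L2 G, ξ ≠ 0 := by
  obtain ⟨K, hK, hK1⟩ := exists_compact_mem_nhds (1 : G)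
  refine ⟨indicatorConstLp 2 hK.measurableSet (hK.measure_ne_top (μ := Measure.haar)) 1, ?_⟩
  rw [← norm_ne_zero_iff, norm_indicatorConstLp (by simp) (by simp)]
  have : 0 < (Measure.haar : Measure G).real K :=
    ENNReal.toReal_pos (Measure.measure_pos_of_mem_nhds Measure.haar hK1).ne' hK.measure_ne_top
  exact mul_ne_zero (by simp) (Real.rpow_pos_of_pos this _).ne'

theorem norm_leftRegVN_le (x : G) : ‖leftRegVN G x‖ ≤ 1 :=
  ContinuousLinearMap.opNorm_le_bound _ zero_le_one fun ξ => by
    rw [one_mul]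
    exact (norm_leftReg_apply x ξ).le

/-- The cb-multiplier norm dominates the supremum norm. -/
theorem IsCbMultiplier.enorm_apply_le [T2Space G] (hf : IsCbMultiplier f C) (x : G) :
    ‖f x‖ₑ ≤ C := by
  obtain ⟨S, hS, hC⟩ := hf
  obtain ⟨ξ, hξ⟩ := exists_L2_ne_zero G
  -- This functional takes at `x` the value `‖ξ‖²`, which is also the bound for its matrix norm.
  -- Testing `M_f` on it therefore loses nothing, and `‖ξ‖²` cancels.
  let φ : FourierAlgebra G := ⟨_, vectorFunctional_mem (VN G) ξ (leftReg G x ξ)⟩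
  have hφ : ‖FourierAlgebra.toFun φ x‖ₑ = ENNReal.ofReal (‖ξ‖ ^ 2) := by
    have : FourierAlgebra.toFun φ x = ⟪leftReg G x ξ, leftReg G x ξ⟫_ℂ := rfl
    rw [this, ← ofReal_norm, inner_self_eq_norm_sq_to_K, norm_leftReg_apply]
    simp
  have h1 := enorm_apply_le_matNorm (VN G) ((Matrix.of fun _ _ : Fin 1 => φ).map S)
    (leftRegVN G x) (norm_leftRegVN_le x)
  have h2 := hC 1 (Matrix.of fun _ _ : Fin 1 => φ)
  have h3 := matNorm_vectorFunctional_le (VN G) ξ (leftReg G x ξ)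
  rw [norm_leftReg_apply, ← sq] at h3
  have h4 : ‖f x‖ₑ * ENNReal.ofReal (‖ξ‖ ^ 2) ≤ C * ENNReal.ofReal (‖ξ‖ ^ 2) := by
    rw [← hφ, ← enorm_mul, ← hS]
    refine (h1.trans h2).trans ?_
    rw [hφ]
    gcongr
  have h5 : ENNReal.ofReal (‖ξ‖ ^ 2) ≠ 0 := by
    rw [Ne, ENNReal.ofReal_eq_zero, not_le]
    positivity
  exact (ENNReal.mul_le_mul_iff_left h5 ENNReal.ofReal_ne_top).1 h4

theorem enorm_apply_le_cbNorm [T2Space G] (f : G → ℂ) (x : G) : ‖f x‖ₑ ≤ cbNorm f := by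
  refine le_of_forall_gt fun r hr => ?_
  obtain ⟨C, hC, hfC⟩ := exists_isCbMultiplier_of_cbNorm_lt hr
  exact (hfC.enorm_apply_le x).trans_lt hC

theorem toFun_mem_Mcb [T2Space G] (φ : FourierAlgebra G) : FourierAlgebra.toFun φ ∈ Mcb G :=
  (cbNorm_toFun_le φ (C := ‖φ‖₊ + 1) (by positivity) (by simp)).trans_lt ENNReal.coe_lt_top

end Multipliers

/-! ### The two inclusions between the ideals. -/

section Synthesis

variable {G : Type u} [Group G] [TopologicalSpace G] [IsTopologicalGroup G]
  [LocallyCompactSpace G] [MeasurableSpace G] [BorelSpace G] [T2Space G]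

theorem idealJcb_subset_idealIcb (F : Set G) : idealJcb F ⊆ idealIcb F := by
  rintro f ⟨hf, happ⟩
  refine ⟨⟨hf, fun ε hε => ?_⟩, fun x hx => ?_⟩
  · obtain ⟨_, ⟨φ, -, rfl⟩, h⟩ := happ ε hε
    exact ⟨_, ⟨φ, rfl⟩, h⟩
  · rw [← enorm_eq_zero]
    refine nonpos_iff_eq_zero.1 (le_of_forall_gt fun ε hε => ?_)
    obtain ⟨_, ⟨φ, hφ, rfl⟩, -, h⟩ := happ ε hε
    have h0 : FourierAlgebra.toFun φ x = 0 := by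
      by_contra hne
      exact Set.disjoint_left.1 hφ.2 (subset_tsupport _ hne) hx
    have := (enorm_apply_le_cbNorm (f - FourierAlgebra.toFun φ) x).trans_lt h
    rwa [Pi.sub_apply, h0, sub_zero] at this

omit [T2Space G] in
/-- If `A_cb(G)` has approximate units, then the elements of `I_cb(F)` can be approximated by
elements of `I(F)`. -/
theorem WeaklyAmenable.exists_idealI_cbNorm_sub_lt (hG : WeaklyAmenable G) {F : Set G}
    {f : G → ℂ} (hf : f ∈ idealIcb F) {ε : ℝ≥0} (hε : 0 < ε) :
    ∃ φ ∈ idealI F, cbNorm (f - FourierAlgebra.toFun φ) < ε := by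
  obtain ⟨ι, _, _, _, e, -, he, -, hlim⟩ := hG
  obtain ⟨C, -, hC⟩ := exists_isCbMultiplier_of_cbNorm_lt hf.1.1
  have hε2 : (0 : ℝ≥0∞) < (ε / 2 : ℝ≥0) := ENNReal.coe_pos.2 (half_pos hε)
  obtain ⟨i, hi⟩ := ((hlim f hf.1).eventually_lt_const hε2).exists
  -- The error `e i - α` will be multiplied by `f`, of multiplier bound `C`; `C + 1` avoids dividing
  -- by zero.
  have hδ : (0 : ℝ≥0∞) < (ε / 2 / (C + 1) : ℝ≥0) := by
    have : 0 < ε / 2 / (C + 1) := by positivity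
    exact_mod_cast this
  obtain ⟨_, ⟨α, rfl⟩, -, hα⟩ := (he i).2 _ hδ
  obtain ⟨D, hD, hDα⟩ := exists_isCbMultiplier_of_cbNorm_lt hα
  obtain ⟨S, hS, -⟩ := id hC
  -- The witness is the product `fα`: it lies in A(G) because `S` is multiplication by `f` there.
  refine ⟨S α, fun x hx => by rw [hS, hf.2 x hx, zero_mul], ?_⟩
  have heq : f - FourierAlgebra.toFun (S α) =
      -(f * e i - f) + f * (e i - FourierAlgebra.toFun α) := by
    ext x
    simp only [Pi.sub_apply, Pi.add_apply, Pi.neg_apply, Pi.mul_apply, hS α x]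
    ring
  have h1 : cbNorm (f * (e i - FourierAlgebra.toFun α)) ≤ (ε / 2 : ℝ≥0) := by
    refine (hC.mul hDα).cbNorm_le.trans ?_
    have hD' : D ≤ ε / 2 / (C + 1) := by exact_mod_cast hD.le
    have : C * D ≤ ε / 2 := by
      calc C * D ≤ (C + 1) * (ε / 2 / (C + 1)) := by
            gcongr
            exact le_add_of_nonneg_right zero_le_one
        _ = ε / 2 := mul_div_cancel₀ _ (by positivity)
    exact_mod_cast this
  rw [heq]
  calc _ ≤ cbNorm (-(f * e i - f)) + cbNorm (f * (e i - FourierAlgebra.toFun α)) :=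
        cbNorm_add_le _ _
    _ < (ε / 2 : ℝ≥0) + (ε / 2 : ℝ≥0) :=
        ENNReal.add_lt_add_of_lt_of_le (h1.trans_lt ENNReal.coe_lt_top).ne
          ((cbNorm_neg_le _).trans_lt hi) h1
    _ = ε := by rw [← ENNReal.coe_add, add_halves]

/-- Half of the error goes to replacing `f` by `φ` in `idealI F`, in the cb-norm. The other half
goes to approximating `φ` in the norm of A(G), where synthesis applies; `cbNorm_toFun_le` converts
it to the cb-norm. -/
theorem WeaklyAmenable.idealIcb_subset_idealJcb (hG : WeaklyAmenable G) {F : Set G}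
    (hF : idealI F ⊆ idealJ F) : idealIcb F ⊆ idealJcb F := by
  intro f hf
  refine ⟨hf.1.1, fun r hr => ?_⟩
  obtain ⟨ε, hε, hεr⟩ := ENNReal.lt_iff_exists_nnreal_btwn.1 hr
  have hε0 : 0 < ε / 2 := half_pos (by exact_mod_cast hε)
  obtain ⟨φ, hφ, hlt⟩ := hG.exists_idealI_cbNorm_sub_lt hf hε0
  obtain ⟨ψ, hψ, hdist⟩ := Metric.mem_closure_iff.1 (hF hφ) (ε / 2 : ℝ≥0) hε0
  refine ⟨_, ⟨ψ, hψ, rfl⟩, toFun_mem_Mcb ψ, ?_⟩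
  have heq : f - FourierAlgebra.toFun ψ =
      (f - FourierAlgebra.toFun φ) + FourierAlgebra.toFun (φ - ψ) := by
    have : FourierAlgebra.toFun (φ - ψ) = FourierAlgebra.toFun φ - FourierAlgebra.toFun ψ := rfl
    rw [this, sub_add_sub_cancel]
  have h2 : cbNorm (FourierAlgebra.toFun (φ - ψ)) ≤ (ε / 2 : ℝ≥0) :=
    cbNorm_toFun_le _ hε0 ((dist_eq_norm φ ψ).symm.trans_le hdist.le)
  rw [heq]
  calc _ ≤ _ := cbNorm_add_le _ _
    _ ≤ (ε / 2 : ℝ≥0) + (ε / 2 : ℝ≥0) := add_le_add hlt.le h2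
    _ = ε := by rw [← ENNReal.coe_add, add_halves]
    _ < r := hεr

end Synthesis

end
end FourierAlg

theorem mainTheorem8 {G : Type u} [Group G] [TopologicalSpace G] [IsTopologicalGroup G]
    [LocallyCompactSpace G] [T2Space G] [MeasurableSpace G] [BorelSpace G]
    (hG : FourierAlg.WeaklyAmenable G)
    (F : Set G) (hF : FourierAlg.IsSynthesisSet F) :
    FourierAlg.IsSynthesisSetCb F :=
  ⟨hF.1, (FourierAlg.idealJcb_subset_idealIcb F).antisymm
    (hG.idealIcb_subset_idealJcb hF.2.symm.subset)⟩
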